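/- A \emph{restriction category} is a category in which every morphism $f\colon M\to N$ has an assigned restriction idempotent $\bar f\colon M\to M$ with $f\bar f=f$, $\bar f\,\bar g=\bar g\,\bar f$ and $\overline{g\bar f}=\bar g\,\bar f$ for $f,g$ with the same domain, and $\bar g f=f\,\overline{gf}$ for composable $f,g$. It is \emph{split} if every idempotent $e=\bar e$ splits; $f$ is \emph{total} if $\bar f=\mathsf{id}$. Let $\mathsf{sRCat}$ be the $2$-category of split restriction categories, functors preserving restriction idempotents, and natural transformations with total components. A \emph{tangentad} in a $2$-category $\mathbf K$ is an object $\mathbb X$ with a $1$-morphism $\mathrm T\colon\mathbb X\to\mathbb X$ and $2$-morphisms $p\colon\mathrm T\Rightarrow\mathsf{id}$, $z\colon\mathsf{id}\Rightarrow\mathrm T$, $s\colon\mathrm T_2\Rightarrow\mathrm T$, $l\colon\mathrm T\Rightarrow\mathrm T^2$, $c\colon\mathrm T^2\Rightarrow\mathrm T^2$ satisfying the axioms of a tangent structure, where the $n$-fold pullbacks $\mathrm T_n$ of $p$ ($n\ge 1$) and the pullback expressing the universality of $l$ are preserved by precomposition with every $1$-morphism into $\mathbb X$, and the former also by all iterates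 of $\mathrm T$. A \emph{tangent split restriction category} is a tangentad in $\mathsf{sRCat}$. For tangentads, $[\mathbb X',\mathbb T'\,\|\,\mathbb X,\mathbb T]$ denotes the category of lax tangent morphisms $(G,\beta\colon G\mathrm T'\Rightarrow\mathrm TG)$ and tangent $2$-morphisms, with tangent bundle functor $\bar{\mathrm T}(G,\beta)=(\mathrm T,c)\circ(G,\beta)$; a \emph{vector field} in it is a tangent $2$-morphism $u\colon(G,\beta)\Rightarrow\bar{\mathrm T}(G,\beta)$ with $p_G\circ u=\mathsf{id}$, and a morphism of vector fields is a tangent $2$-morphism $\varphi$ with $u'\circ\varphi=\mathrm T\varphi\circ u$. A tangentad $(\mathbb X,\mathbb T)$ \emph{admits the construction of vector fields} if there are a tangentad $\mathbb V$ (the \emph{tangentad of vector fields}), a strict tangent morphism $U\colon\mathbb V\to(\mathbb X,\mathbb T)$ and a vector field $\hat v\colon U\Rightarrow\bar{\mathrm T}U$ in $[\mathbb V\,\|\,\mathbb X,\mathbb T]$ such that for every tangentad $(\mathbb X',\mathbb T')$ the functor $H\mapsto(U\circ H,\hat v_H)$ from $[\mathbb X',\mathbb T'\,\|\,\mathbb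 V]$ to the category of vector fields in $[\mathbb X',\mathbb T'\,\|\,\mathbb X,\mathbb T]$ is an isomorphism. \textbf{Theorem.} The $2$-category $\mathsf{sRCat}$ admits inserters and equifiers, and every tangentad in $\mathsf{sRCat}$ admits the construction of vector fields. Moreover, for a tangent split restriction category $(\mathbb X,\mathbb T)$, the tangentad of vector fields is the following tangent split restriction category $\mathsf{VF}(\mathbb X,\mathbb T)$. Its objects are the pairs $(M,v)$ of an object $M$ of $\mathbb X$ and a total morphism $v\colon M\to\mathrm TM$ with $p_M\circ v=\mathsf{id}_M$. Its morphisms $f\colon(M,v)\to(N,u)$ are the morphisms $f\colon M\to N$ of $\mathbb X$ with $u\circ f=\mathrm Tf\circ v$ and $v\circ\bar f=\mathrm T\bar f\circ v$. The restriction idempotent of $f$ is $\bar f$. The tangent bundle functor sends $(M,v)$ to $(\mathrm TM,c_M\circ\mathrm Tv)$ and $f$ to $\mathrm Tf$, and the structural transformations are those of $(\mathbb X,\mathbb T)$, that is, the forgetful functor $U\colon(M,v)\mapsto M$ is a strict tangent morphism. The universal vector field $\hat v\colon U\Rightarrow\bar{\mathrm T}U$ has the component $v$ at $(M,v)$. 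-/

import Mathlib

open CategoryTheory Bicategory Limits

universe w v u

namespace Tangentads

/-! ### Inserters and equifiers in a 2-category -/

section TwoLimits

variable {K : Type u} [Bicategory.{w, v} K]

/-- An object of `Insert[Y; F, G]`: a 1-morphism `H : Y ⟶ X` with a 2-morphism `F ∘ H ⟶ G ∘ H`.
Composition of 1-morphisms is written diagrammatically, so `F ∘ H` is `H ≫ F`. -/
structure Insert (Y : K) {X X' : K} (F G : X ⟶ X') where
  H : Y ⟶ X
  τ : H ≫ F ⟶ H ≫ G

namespace Insert

variable {Y X X' : K} {F G : X ⟶ X'}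

/-- A morphism `(H, τ) ⟶ (H', τ')` of `Insert[Y; F, G]`. -/
@[ext]
structure Hom (A B : Insert Y F G) where
  φ : A.H ⟶ B.H
  comm : A.τ ≫ φ ▷ G = φ ▷ F ≫ B.τ

instance : Category (Insert Y F G) where
  Hom := Hom
  id A := ⟨𝟙 A.H, by simp⟩
  comp f g := ⟨f.φ ≫ g.φ, by
    rw [comp_whiskerRight, comp_whiskerRight, ← Category.assoc, f.comm, Category.assoc, g.comm,
      Category.assoc]⟩
  id_comp f := Hom.ext (Category.id_comp f.φ)
  comp_id f := Hom.ext (Category.comp_id f.φ)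
  assoc f g h := Hom.ext (Category.assoc f.φ g.φ h.φ)

/-- The functor `K(Y, I) ⥤ Insert[Y; F, G]` induced by `V : I ⟶ X` and `θ : F ∘ V ⟶ G ∘ V`. -/
def comparison (Y : K) {I : K} (V : I ⟶ X) (θ : V ≫ F ⟶ V ≫ G) :
    (Y ⟶ I) ⥤ Insert Y F G where
  obj H := ⟨H ≫ V, (α_ H V F).hom ≫ H ◁ θ ≫ (α_ H V G).inv⟩
  map {H H'} ψ := ⟨ψ ▷ V, by
    have h := whisker_exchange ψ θ
    simp only [whiskerRight_comp] at h
    rw [← cancel_epi (α_ H V F).inv, ← cancel_mono (α_ H' V G).hom]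
    simpa using h⟩
  map_id H := Hom.ext (id_whiskerRight H V)
  map_comp f g := Hom.ext (comp_whiskerRight f g V)

end Insert

/-- `(I, V, θ)` is an inserter of `F` and `G`. -/
def IsInserter {X X' I : K} {F G : X ⟶ X'} (V : I ⟶ X) (θ : V ≫ F ⟶ V ≫ G) : Prop :=
  ∀ Y : K, (Insert.comparison Y V θ).IsIso

/-- `Equif(Y; φ, ψ)`: the full subcategory of `K(Y, X)` on the `H` with `φ_H = ψ_H`. -/
abbrev Equif (Y : K) {X X' : K} {F G : X ⟶ X'} (φ ψ : F ⟶ G) : Type v :=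
  ObjectProperty.FullSubcategory (fun H : Y ⟶ X => H ◁ φ = H ◁ ψ)

/-- The functor `K(Y, E) ⥤ Equif(Y; φ, ψ)` induced by `W : E ⟶ X` with `φ_W = ψ_W`. -/
def Equif.comparison (Y : K) {X X' E : K} {F G : X ⟶ X'} {φ ψ : F ⟶ G} (W : E ⟶ X)
    (hW : W ◁ φ = W ◁ ψ) : (Y ⟶ E) ⥤ Equif Y φ ψ :=
  ObjectProperty.lift _ ((postcomposing Y E X).obj W) (fun H => by
    change (H ≫ W) ◁ φ = (H ≫ W) ◁ ψ
    rw [comp_whiskerLeft, comp_whiskerLeft, hW])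

/-- `(E, W)` is an equifier of `φ` and `ψ`. -/
def IsEquifier {X X' E : K} {F G : X ⟶ X'} (φ ψ : F ⟶ G) (W : E ⟶ X) : Prop :=
  ∃ hW : W ◁ φ = W ◁ ψ, ∀ Y : K, (Equif.comparison Y W hW).IsIso

variable (K)

/-- The 2-category `K` admits inserters. -/
def AdmitsInserters : Prop :=
  ∀ {X X' : K} (F G : X ⟶ X'), ∃ (I : K) (V : I ⟶ X) (θ : V ≫ F ⟶ V ≫ G), IsInserter V θ

/-- The 2-category `K` admits equifiers. -/
def AdmitsEquifiers : Prop :=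
  ∀ {X X' : K} {F G : X ⟶ X'} (φ ψ : F ⟶ G), ∃ (E : K) (W : E ⟶ X), IsEquifier φ ψ W

end TwoLimits

/-! ### Tangentads -/

section Tangentad

variable {K : Type u} [Bicategory.{w, v} K]

/-- The iterates `Tᵐ` of an endomorphism `T`. -/
def iter {X : K} (T : X ⟶ X) : ℕ → (X ⟶ X)
  | 0 => 𝟙 X
  | m + 1 => iter T m ≫ T

/-- For `n` positive: the `π i : P ⟶ E` exhibit `P` as the `n`-fold pullback of `q : E ⟶ B` along
itself. -/
def IsFoldPullback {C : Type*} [Category* C] {P E B : C} (q : E ⟶ B) {n : ℕ}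
    (π : Fin n → (P ⟶ E)) : Prop :=
  (∀ i j, π i ≫ q = π j ≫ q) ∧
    ∀ (Z : C) (f : Fin n → (Z ⟶ E)), (∀ i j, f i ≫ q = f j ≫ q) → ∃! g : Z ⟶ P, ∀ i, g ≫ π i = f i

/-- A tangent structure on an object `X` of a 2-category. As composition is diagrammatic,
`α ▷ T` is `T α` (that is, `T(α_M)`) and `T ◁ α` is `α_T` (that is, `α_{TM}`). A pullback in the
category of endomorphisms of `X` is pointwise when it is preserved by precomposition with every
`F : Y ⟶ X`, i.e. by `F ◁ -`. -/
structure TangentStructure (X : K) where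
  /-- The tangent bundle 1-morphism. -/
  T : X ⟶ X
  /-- The projection. -/
  p : T ⟶ 𝟙 X
  /-- The 2-fold pullback of the projection along itself. -/
  T₂ : X ⟶ X
  π₁ : T₂ ⟶ T
  π₂ : T₂ ⟶ T
  /-- The zero morphism. -/
  z : 𝟙 X ⟶ T
  /-- The sum morphism. -/
  s : T₂ ⟶ T
  /-- The vertical lift. -/
  l : T ⟶ T ≫ T
  /-- The canonical flip. -/
  c : T ≫ T ⟶ T ≫ T
  /-- `T₂` is a pointwise pullback preserved by all iterates of `T`. -/
  isPullback : ∀ {Y : K} (F : Y ⟶ X) (m : ℕ),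
    IsPullback (F ◁ π₁ ▷ iter T m) (F ◁ π₂ ▷ iter T m) (F ◁ p ▷ iter T m) (F ◁ p ▷ iter T m)
  /-- All pointwise `n`-fold pullbacks of `p` along itself exist and are preserved by all iterates
  of `T`. -/
  exists_foldPullback : ∀ n : ℕ, 0 < n → ∃ (P : X ⟶ X) (π : Fin n → (P ⟶ T)),
    ∀ {Y : K} (F : Y ⟶ X) (m : ℕ),
      IsFoldPullback (F ◁ p ▷ iter T m) (fun i => F ◁ π i ▷ iter T m)
  /- `(p, z, s)` is an additive bundle. -/
  z_p : z ≫ p = 𝟙 (𝟙 X)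
  s_p : s ≫ p = π₁ ≫ p
  /-- Associativity; `a` and `b` stand for `⟨f, g⟩` and `⟨g, h⟩`. -/
  s_assoc : ∀ {P : X ⟶ X} (a b : P ⟶ T₂), a ≫ π₂ = b ≫ π₁ → ∃ d e : P ⟶ T₂,
    d ≫ π₁ = a ≫ s ∧ d ≫ π₂ = b ≫ π₂ ∧ e ≫ π₁ = a ≫ π₁ ∧ e ≫ π₂ = b ≫ s ∧ d ≫ s = e ≫ s
  s_unit : ∃ a : T ⟶ T₂, a ≫ π₁ = p ≫ z ∧ a ≫ π₂ = 𝟙 T ∧ a ≫ s = 𝟙 T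
  s_comm : ∃ τ : T₂ ⟶ T₂, τ ≫ π₁ = π₂ ∧ τ ≫ π₂ = π₁ ∧ τ ≫ s = s
  /- `(z, l) : p ⟶ T p` is an additive bundle morphism. -/
  l_p : l ≫ p ▷ T = p ≫ z ≫ (λ_ T).inv
  z_l : z ≫ l = z ≫ (λ_ T).inv ≫ z ▷ T
  s_l : ∃ a : T₂ ⟶ T₂ ≫ T, a ≫ π₁ ▷ T = π₁ ≫ l ∧ a ≫ π₂ ▷ T = π₂ ≫ l ∧ s ≫ l = a ≫ s ▷ T
  /- `(id, c) : T p ⟶ p_T` is an additive bundle morphism. -/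
  c_p : c ≫ T ◁ p ≫ (ρ_ T).hom = p ▷ T ≫ (λ_ T).hom
  z_c : (λ_ T).inv ≫ z ▷ T ≫ c = (ρ_ T).inv ≫ T ◁ z
  s_c : ∃ a : T₂ ≫ T ⟶ T ≫ T₂,
    a ≫ T ◁ π₁ = π₁ ▷ T ≫ c ∧ a ≫ T ◁ π₂ = π₂ ▷ T ≫ c ∧ s ▷ T ≫ c = a ≫ T ◁ s
  /- The vertical lift is coassociative and compatible with the canonical flip. -/
  l_l : l ≫ l ▷ T ≫ (α_ T T T).hom = l ≫ T ◁ l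
  l_c : l ≫ c = l
  l_c_c : T ◁ l ≫ (α_ T T T).inv ≫ c ▷ T ≫ (α_ T T T).hom ≫ T ◁ c =
    c ≫ l ▷ T ≫ (α_ T T T).hom
  /- The canonical flip is a symmetric braiding. -/
  c_c : c ≫ c = 𝟙 (T ≫ T)
  c_braid : c ▷ T ≫ (α_ T T T).hom ≫ T ◁ c ≫ (α_ T T T).inv ≫ c ▷ T =
    (α_ T T T).hom ≫ T ◁ c ≫ (α_ T T T).inv ≫ c ▷ T ≫ (α_ T T T).hom ≫ T ◁ c ≫ (α_ T T T).inv
  /-- The tangent bundle is locally linear; `a` is `⟨l ∘ π₁, z_T ∘ π₂⟩`. -/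
  l_universal : ∃ a : T₂ ⟶ T₂ ≫ T,
    a ≫ π₁ ▷ T = π₁ ≫ l ∧ a ≫ π₂ ▷ T = π₂ ≫ (ρ_ T).inv ≫ T ◁ z ∧
      ∀ {Y : K} (F : Y ⟶ X), IsPullback (F ◁ (a ≫ s ▷ T)) (F ◁ (π₁ ≫ p))
        (F ◁ (p ▷ T ≫ (λ_ T).hom)) (F ◁ z)

variable (K) in
/-- A tangentad of the 2-category `K`. -/
structure Tangentad where
  X : K
  str : TangentStructure X

namespace Tangentad

abbrev T (A : Tangentad K) : A.X ⟶ A.X := A.str.T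
abbrev T₂ (A : Tangentad K) : A.X ⟶ A.X := A.str.T₂
abbrev p (A : Tangentad K) : A.T ⟶ 𝟙 A.X := A.str.p
abbrev z (A : Tangentad K) : 𝟙 A.X ⟶ A.T := A.str.z
abbrev s (A : Tangentad K) : A.T₂ ⟶ A.T := A.str.s
abbrev l (A : Tangentad K) : A.T ⟶ A.T ≫ A.T := A.str.l
abbrev c (A : Tangentad K) : A.T ≫ A.T ⟶ A.T ≫ A.T := A.str.c

end Tangentad

/-- For `α : F ∘ T ⟶ T' ∘ F`, the 2-morphism `T' α ∘ α_T : F ∘ T² ⟶ T'² ∘ F`. -/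
def twice {A B : Tangentad K} {F : A.X ⟶ B.X} (α : A.T ≫ F ⟶ F ≫ B.T) :
    (A.T ≫ A.T) ≫ F ⟶ F ≫ B.T ≫ B.T :=
  (α_ _ _ _).hom ≫ A.T ◁ α ≫ (α_ _ _ _).inv ≫ α ▷ B.T ≫ (α_ _ _ _).hom

/-- `α : F ∘ T ⟶ T' ∘ F` is a lax distributive law. -/
structure IsLaxLaw {A B : Tangentad K} {F : A.X ⟶ B.X} (α : A.T ≫ F ⟶ F ≫ B.T) : Prop where
  p : α ≫ F ◁ B.p ≫ (ρ_ F).hom = A.p ▷ F ≫ (λ_ F).hom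
  z : (λ_ F).inv ≫ A.z ▷ F ≫ α = (ρ_ F).inv ≫ F ◁ B.z
  s : ∃ a : A.T₂ ≫ F ⟶ F ≫ B.T₂,
    a ≫ F ◁ B.str.π₁ = A.str.π₁ ▷ F ≫ α ∧ a ≫ F ◁ B.str.π₂ = A.str.π₂ ▷ F ≫ α ∧
      A.s ▷ F ≫ α = a ≫ F ◁ B.s
  l : A.l ▷ F ≫ twice α = α ≫ F ◁ B.l
  c : A.c ▷ F ≫ twice α = twice α ≫ F ◁ B.c

/-- A lax tangent 1-morphism. -/
structure LaxMor (A B : Tangentad K) where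
  F : A.X ⟶ B.X
  law : A.T ≫ F ⟶ F ≫ B.T
  isLaxLaw : IsLaxLaw law

/-- A lax tangent 1-morphism is strict when its distributive law is an identity. -/
def LaxMor.IsStrict {A B : Tangentad K} (F : LaxMor A B) : Prop :=
  ∃ h : A.T ≫ F.F = F.F ≫ B.T, F.law = eqToHom h

/-- A tangent 2-morphism. -/
@[ext]
structure LaxMor.Hom {A B : Tangentad K} (F G : LaxMor A B) where
  φ : F.F ⟶ G.F
  comm : F.law ≫ φ ▷ B.T = A.T ◁ φ ≫ G.law

/-- The Hom-category `[A ‖ B]` of lax tangent 1-morphisms and tangent 2-morphisms. -/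
instance (A B : Tangentad K) : Category (LaxMor A B) where
  Hom := LaxMor.Hom
  id F := ⟨𝟙 F.F, by simp⟩
  comp f g := ⟨f.φ ≫ g.φ, by
    rw [comp_whiskerRight, whiskerLeft_comp, ← Category.assoc, f.comm, Category.assoc, g.comm,
      Category.assoc]⟩
  id_comp f := LaxMor.Hom.ext (Category.id_comp f.φ)
  comp_id f := LaxMor.Hom.ext (Category.comp_id f.φ)
  assoc f g h := LaxMor.Hom.ext (Category.assoc f.φ g.φ h.φ)

theorem twice_comp {A B C : Tangentad K} {F : A.X ⟶ B.X} {G : B.X ⟶ C.X}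
    (α : A.T ≫ F ⟶ F ≫ B.T) (β : B.T ≫ G ⟶ G ≫ C.T) :
    twice (A := A) (B := C) ((α_ _ _ _).inv ≫ α ▷ G ≫ (α_ _ _ _).hom ≫ F ◁ β ≫ (α_ _ _ _).inv) =
      (α_ _ _ _).inv ≫ twice α ▷ G ≫ (α_ _ _ _).hom ≫ F ◁ twice β ≫ (α_ _ _ _).inv := by
  have h := whisker_exchange α β
  have h' : A.T ◁ F ◁ β ≫ (α_ A.T F (G ≫ C.T)).inv ≫ (α_ (A.T ≫ F) G C.T).inv ≫ α ▷ G ▷ C.T =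
      (α_ A.T F (B.T ≫ G)).inv ≫ (α_ (A.T ≫ F) B.T G).inv ≫ α ▷ B.T ▷ G ≫
        (α_ (F ≫ B.T) B.T G).hom ≫ (α_ F B.T (B.T ≫ G)).hom ≫ F ◁ B.T ◁ β ≫
          (α_ F B.T (G ≫ C.T)).inv ≫ (α_ (F ≫ B.T) G C.T).inv := by
    rw [← cancel_epi (α_ A.T F _).hom, ← cancel_mono (α_ (F ≫ B.T) G C.T).hom]
    simpa using h
  simp [twice, reassoc_of% h']

/-- Composition of lax tangent 1-morphisms. -/
def LaxMor.comp {A B C : Tangentad K} (F : LaxMor A B) (G : LaxMor B C) : LaxMor A C where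
  F := F.F ≫ G.F
  law := (α_ _ _ _).inv ≫ F.law ▷ G.F ≫ (α_ _ _ _).hom ≫ F.F ◁ G.law ≫ (α_ _ _ _).inv
  isLaxLaw :=
    { p := by
        have h1 := congrArg (· ▷ G.F) F.isLaxLaw.p
        have h2 := congrArg (F.F ◁ ·) G.isLaxLaw.p
        simp at h1 h2 ⊢
        rw [h2, h1]
      z := by
        have h1 := congrArg (· ▷ G.F) F.isLaxLaw.z
        have h2 := congrArg (F.F ◁ ·) G.isLaxLaw.z
        simp at h1 h2 ⊢
        rw [reassoc_of% h1, Iso.inv_hom_id_assoc, reassoc_of% h2]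
      s := by
        obtain ⟨a, h1, h2, h3⟩ := F.isLaxLaw.s
        obtain ⟨b, k1, k2, k3⟩ := G.isLaxLaw.s
        refine ⟨(α_ _ _ _).inv ≫ a ▷ G.F ≫ (α_ _ _ _).hom ≫ F.F ◁ b ≫ (α_ _ _ _).inv, ?_, ?_, ?_⟩
        · have h1' := congrArg (· ▷ G.F) h1
          have k1' := congrArg (F.F ◁ ·) k1
          have e : a ▷ G.F ≫ (α_ F.F B.T₂ G.F).hom ≫ F.F ◁ B.str.π₁ ▷ G.F =
              A.str.π₁ ▷ F.F ▷ G.F ≫ F.law ▷ G.F ≫ (α_ F.F B.T G.F).hom := by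
            rw [← cancel_mono (α_ F.F B.T G.F).inv]
            simpa using h1'
          simp at k1' ⊢
          rw [reassoc_of% k1', reassoc_of% e]
        · have h2' := congrArg (· ▷ G.F) h2
          have k2' := congrArg (F.F ◁ ·) k2
          have e : a ▷ G.F ≫ (α_ F.F B.T₂ G.F).hom ≫ F.F ◁ B.str.π₂ ▷ G.F =
              A.str.π₂ ▷ F.F ▷ G.F ≫ F.law ▷ G.F ≫ (α_ F.F B.T G.F).hom := by
            rw [← cancel_mono (α_ F.F B.T G.F).inv]
            simpa using h2'
          simp at k2' ⊢
          rw [reassoc_of% k2', reassoc_of% e]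
        · have h3' := congrArg (· ▷ G.F) h3
          have k3' := congrArg (F.F ◁ ·) k3
          simp at h3' k3' ⊢
          rw [reassoc_of% h3', ← reassoc_of% k3']
          simp
      l := by
        rw [twice_comp]
        have h1 := congrArg (· ▷ G.F) F.isLaxLaw.l
        have h2 := congrArg (F.F ◁ ·) G.isLaxLaw.l
        simp at h1 h2 ⊢
        rw [reassoc_of% h1, ← reassoc_of% h2]
        simp
      c := by
        rw [twice_comp]
        have h1 := congrArg (· ▷ G.F) F.isLaxLaw.c
        have h2 := congrArg (F.F ◁ ·) G.isLaxLaw.c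
        simp at h1 h2 ⊢
        rw [reassoc_of% h1, ← reassoc_of% h2]
        simp }

/-- The strong tangent 1-morphism `(T, c) : A ⟶ A`. -/
def Tangentad.tangent (A : Tangentad K) : LaxMor A A where
  F := A.T
  law := A.c
  isLaxLaw :=
    { p := A.str.c_p
      z := A.str.z_c
      s := A.str.s_c
      l := by
        have h1 : A.l ▷ A.T = A.c ≫ A.T ◁ A.l ≫ (α_ A.T A.T A.T).inv ≫ A.c ▷ A.T ≫
            (α_ A.T A.T A.T).hom ≫ A.T ◁ A.c ≫ (α_ A.T A.T A.T).inv := by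
          have h := reassoc_of% A.str.l_c_c
          rw [h, reassoc_of% A.str.c_c]
          simp
        have h2 : A.T ◁ A.c ≫ A.T ◁ A.c = 𝟙 _ := by
          rw [← whiskerLeft_comp, A.str.c_c, whiskerLeft_id]
        have h3 : A.c ▷ A.T ≫ A.c ▷ A.T = 𝟙 _ := by
          rw [← comp_whiskerRight, A.str.c_c, id_whiskerRight]
        rw [h1]
        simp [twice, reassoc_of% h2, reassoc_of% h3]
      c := by
        have h := A.str.c_braid
        rw [← cancel_mono (α_ A.T A.T A.T).inv]
        simpa [twice] using h }

/-- The tangent bundle `T̄ F = (T, c) ∘ F` of `F` in the Hom-category `[A ‖ B]`. -/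
abbrev LaxMor.tangent {A B : Tangentad K} (F : LaxMor A B) : LaxMor A B := F.comp B.tangent

/-- A vector field in the Hom-tangent category `[A ‖ B]`: a section `u : G ⟶ T̄ G`, in `[A ‖ B]`, of
the projection `p_G : T̄ G ⟶ G`. -/
structure VectorField (A B : Tangentad K) where
  G : LaxMor A B
  u : G ⟶ G.tangent
  section_p : u.φ ≫ G.F ◁ B.p ≫ (ρ_ G.F).hom = 𝟙 G.F

/-- The underlying 2-morphism `G ⟶ T ∘ G` of a vector field. -/
def VectorField.vec {A B : Tangentad K} (x : VectorField A B) : x.G.F ⟶ x.G.F ≫ B.T := x.u.φ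

namespace VectorField

variable {A B : Tangentad K}

/-- A morphism of vector fields in the Hom-tangent category `[A ‖ B]`. -/
@[ext]
structure Hom (x y : VectorField A B) where
  f : x.G ⟶ y.G
  comm : x.vec ≫ f.φ ▷ B.T = f.φ ≫ y.vec

/-- The category `VF[A ‖ B]` of vector fields of the Hom-tangent category `[A ‖ B]`. -/
instance : Category (VectorField A B) where
  Hom := Hom
  id x := ⟨𝟙 x.G, by
    change x.vec ≫ (𝟙 x.G.F) ▷ B.T = 𝟙 x.G.F ≫ x.vec
    simp⟩
  comp f g := ⟨f.f ≫ g.f, by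
    change _ ≫ (f.f.φ ≫ g.f.φ) ▷ B.T = (f.f.φ ≫ g.f.φ) ≫ _
    rw [comp_whiskerRight, ← Category.assoc, f.comm, Category.assoc, g.comm, Category.assoc]⟩
  id_comp f := Hom.ext (Category.id_comp f.f)
  comp_id f := Hom.ext (Category.comp_id f.f)
  assoc f g h := Hom.ext (Category.assoc f.f g.f h.f)

variable {C : Tangentad K}

/-- The functor `Γ_u : [C ‖ A] ⥤ VF[C ‖ B]` induced by a vector field `(G, u)` in `[A ‖ B]`; it
sends `H` to `G ∘ H` with the vector field `u_H`. -/
def Γ (x : VectorField A B) (C : Tangentad K) : LaxMor C A ⥤ VectorField C B where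
  obj H :=
    { G := H.comp x.G
      u := ⟨H.F ◁ x.vec ≫ (α_ _ _ _).inv, by
        have h : x.G.law ≫ x.vec ▷ B.T = A.T ◁ x.vec ≫ x.G.tangent.law := x.u.comm
        have h1 := congrArg (H.F ◁ ·) h
        have h2 := whisker_exchange H.law x.vec
        have h3 : C.T ◁ H.F ◁ x.vec ≫ (α_ C.T H.F (x.G.F ≫ B.T)).inv ≫
            (α_ (C.T ≫ H.F) x.G.F B.T).inv ≫ H.law ▷ x.G.F ▷ B.T =
            (α_ C.T H.F x.G.F).inv ≫ H.law ▷ x.G.F ≫ (α_ H.F A.T x.G.F).hom ≫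
              H.F ◁ A.T ◁ x.vec ≫ (α_ H.F A.T (x.G.F ≫ B.T)).inv ≫
                (α_ (H.F ≫ A.T) x.G.F B.T).inv := by
          rw [← cancel_epi (α_ C.T H.F x.G.F).hom, ← cancel_mono (α_ (H.F ≫ A.T) x.G.F B.T).hom]
          simpa using h2
        simp [LaxMor.comp, LaxMor.tangent, Tangentad.tangent] at h1 ⊢
        rw [reassoc_of% h3, reassoc_of% h1]
        simp⟩
      section_p := by
        have h : x.vec ≫ x.G.F ◁ B.p ≫ (ρ_ x.G.F).hom = 𝟙 x.G.F := x.section_p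
        have h1 := congrArg (H.F ◁ ·) h
        change (H.F ◁ x.vec ≫ (α_ H.F x.G.F B.T).inv) ≫ (H.F ≫ x.G.F) ◁ B.p ≫
          (ρ_ (H.F ≫ x.G.F)).hom = 𝟙 (H.F ≫ x.G.F)
        rw [Category.assoc]
        simpa using h1 }
  map {H H'} f := ⟨⟨f.φ ▷ x.G.F, by
      have h1 := congrArg (· ▷ x.G.F) f.comm
      have h2 := whisker_exchange f.φ x.G.law
      have h3 : H.F ◁ x.G.law ≫ (α_ H.F x.G.F B.T).inv ≫ f.φ ▷ x.G.F ▷ B.T =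
          (α_ H.F A.T x.G.F).inv ≫ f.φ ▷ A.T ▷ x.G.F ≫ (α_ H'.F A.T x.G.F).hom ≫
            H'.F ◁ x.G.law ≫ (α_ H'.F x.G.F B.T).inv := by
        rw [← cancel_mono (α_ H'.F x.G.F B.T).hom]
        simpa using h2
      simp [LaxMor.comp] at h1 ⊢
      rw [h3, Iso.hom_inv_id_assoc, reassoc_of% h1]
      simp⟩, by
      have h := whisker_exchange f.φ x.vec
      change (H.F ◁ x.vec ≫ (α_ _ _ _).inv) ≫ f.φ ▷ x.G.F ▷ B.T = f.φ ▷ x.G.F ≫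
        H'.F ◁ x.vec ≫ (α_ _ _ _).inv
      simp only [whiskerRight_comp] at h
      rw [← cancel_mono (α_ H'.F x.G.F B.T).hom]
      simpa using h⟩
  map_id H := Hom.ext (LaxMor.Hom.ext (id_whiskerRight H.F x.G.F))
  map_comp f g := Hom.ext (LaxMor.Hom.ext (comp_whiskerRight f.φ g.φ x.G.F))

/-- The vector field `u` is universal: every induced functor `Γ_u : [C ‖ A] ⥤ VF[C ‖ B]` is an
isomorphism of categories. When `G` is strict, `Γ_u` commutes strictly with the tangent structures
of the Hom-categories (its distributive law at `H` is `H ◁ G.law`), so this says that `Γ_u` is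
invertible as a strict tangent morphism. -/
def IsUniversal (x : VectorField A B) : Prop :=
  ∀ C : Tangentad K, (x.Γ C).IsIso

end VectorField

/-- The tangentad `A` admits the construction of vector fields. -/
def Tangentad.AdmitsVectorFields (A : Tangentad K) : Prop :=
  ∃ (W : Tangentad K) (v : VectorField W A), v.G.IsStrict ∧ v.IsUniversal

variable (K) in
/-- The 2-category `K` admits the construction of vector fields. -/
def AdmitsVectorFields : Prop :=
  ∀ A : Tangentad K, A.AdmitsVectorFields

end Tangentad

/-! ### The 2-category of split restriction categories -/

section SRCat

/-- A restriction structure; `res f` is the restriction idempotent `f̄`. -/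
class RestrictionCategory (C : Type u) extends Category.{v} C where
  res : ∀ {X Y : C}, (X ⟶ Y) → (X ⟶ X)
  res_comp_self : ∀ {X Y : C} (f : X ⟶ Y), res f ≫ f = f
  res_comm : ∀ {X Y Z : C} (f : X ⟶ Y) (g : X ⟶ Z), res f ≫ res g = res g ≫ res f
  res_res_comp : ∀ {X Y Z : C} (f : X ⟶ Y) (g : X ⟶ Z), res (res f ≫ g) = res f ≫ res g
  comp_res : ∀ {X Y Z : C} (f : X ⟶ Y) (g : Y ⟶ Z), f ≫ res g = res (f ≫ g) ≫ f

open RestrictionCategory (res)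

/-- A morphism is total when its restriction idempotent is an identity. -/
def Total {C : Type u} [RestrictionCategory.{v} C] {X Y : C} (f : X ⟶ Y) : Prop :=
  res f = 𝟙 X

/-- A split restriction category: each restriction idempotent splits. -/
class SplitRestrictionCategory (C : Type u) extends RestrictionCategory.{v} C where
  split : ∀ {M : C} (e : M ⟶ M), res e = e →
    ∃ (E : C) (r : M ⟶ E) (m : E ⟶ M), m ≫ r = 𝟙 E ∧ r ≫ m = e

section Lemmas

variable {C : Type u} [RestrictionCategory.{v} C]

theorem res_res {X Y : C} (f : X ⟶ Y) : res (res f) = res f := by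
  have h := RestrictionCategory.res_res_comp f (𝟙 X)
  have h1 := RestrictionCategory.res_comp_self (𝟙 X)
  rw [Category.comp_id] at h h1
  rw [h, h1, Category.comp_id]

theorem total_id (X : C) : Total (𝟙 X) := by
  have h1 := RestrictionCategory.res_comp_self (𝟙 X)
  rwa [Category.comp_id] at h1

theorem res_comp_of_total {X Y Z : C} (f : X ⟶ Y) {g : Y ⟶ Z} (hg : Total g) :
    res (f ≫ g) = res f := by
  have h := RestrictionCategory.comp_res f g
  rw [hg, Category.comp_id] at h
  have h2 := RestrictionCategory.res_res_comp (f ≫ g) f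
  rw [← h] at h2
  rw [h2]
  have h3 := RestrictionCategory.res_res_comp f (f ≫ g)
  rw [← Category.assoc, RestrictionCategory.res_comp_self] at h3
  rw [RestrictionCategory.res_comm, ← h3]

theorem Total.comp {X Y Z : C} {f : X ⟶ Y} {g : Y ⟶ Z} (hf : Total f) (hg : Total g) :
    Total (f ≫ g) :=
  (res_comp_of_total f hg).trans hf

theorem total_of_comp_eq_id {X Y : C} {f : X ⟶ Y} {g : Y ⟶ X} (h : f ≫ g = 𝟙 X) : Total f := by
  have h1 := RestrictionCategory.res_res_comp f (f ≫ g)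
  rw [← Category.assoc, RestrictionCategory.res_comp_self, h, show res (𝟙 X) = 𝟙 X from total_id X,
    Category.comp_id] at h1
  exact h1.symm

end Lemmas

/-- A restriction functor. -/
structure RestrictionFunctor (C D : Type*) [RestrictionCategory C] [RestrictionCategory D]
    extends C ⥤ D where
  map_res : ∀ {X Y : C} (f : X ⟶ Y), map (res f) = res (map f)

/-- A total natural transformation between restriction functors. -/
@[ext]
structure TotalNatTrans {C D : Type*} [RestrictionCategory C] [RestrictionCategory D]
    (F G : RestrictionFunctor C D) where
  nat : F.toFunctor ⟶ G.toFunctor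
  total : ∀ X, Total (nat.app X)

theorem RestrictionFunctor.total_map {C D : Type*} [RestrictionCategory C]
    [RestrictionCategory D] (F : RestrictionFunctor C D) {X Y : C} {f : X ⟶ Y} (hf : Total f) :
    Total (F.map f) := by
  unfold Total at *
  rw [← F.map_res, hf, F.map_id]

instance {C D : Type*} [RestrictionCategory C] [RestrictionCategory D] :
    Category (RestrictionFunctor C D) where
  Hom := TotalNatTrans
  id F := ⟨𝟙 F.toFunctor, fun _ => total_id _⟩
  comp f g := ⟨f.nat ≫ g.nat, fun X => (f.total X).comp (g.total X)⟩
  id_comp f := TotalNatTrans.ext (Category.id_comp f.nat)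
  comp_id f := TotalNatTrans.ext (Category.comp_id f.nat)
  assoc f g h := TotalNatTrans.ext (Category.assoc f.nat g.nat h.nat)

/-- Split restriction categories with objects in `Type u` and morphisms in `Type v`. -/
structure SRCat : Type (max (u + 1) (v + 1)) where
  carrier : Type u
  [str : SplitRestrictionCategory.{v} carrier]

attribute [instance] SRCat.str

namespace SRCat

/-- The coherence isomorphism between restriction functors with the same underlying functor. -/
def isoOfNatIso {C D : Type*} [RestrictionCategory C] [RestrictionCategory D]
    {F G : RestrictionFunctor C D} (e : F.toFunctor ≅ G.toFunctor) : F ≅ G where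
  hom := ⟨e.hom, fun X => total_of_comp_eq_id (e.hom_inv_id_app X)⟩
  inv := ⟨e.inv, fun X => total_of_comp_eq_id (e.inv_hom_id_app X)⟩
  hom_inv_id := TotalNatTrans.ext e.hom_inv_id
  inv_hom_id := TotalNatTrans.ext e.inv_hom_id

/-- The (strict) 2-category `sRCat` of split restriction categories, restriction functors and total natural
transformations. -/
instance : Bicategory SRCat.{v, u} where
  Hom X Y := RestrictionFunctor X.carrier Y.carrier
  id X := { 𝟭 X.carrier with map_res := fun _ => rfl }
  comp F G :=
    { F.toFunctor ⋙ G.toFunctor with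
      map_res := fun f => by
        change G.map (F.map (res f)) = res (G.map (F.map f))
        rw [F.map_res, G.map_res] }
  homCategory X Y := inferInstance
  whiskerLeft F _ _ η := ⟨Functor.whiskerLeft F.toFunctor η.nat, fun X => η.total (F.obj X)⟩
  whiskerRight η H := ⟨Functor.whiskerRight η.nat H.toFunctor, fun X => H.total_map (η.total X)⟩
  associator F G H := isoOfNatIso (Functor.associator F.toFunctor G.toFunctor H.toFunctor)
  leftUnitor F := isoOfNatIso F.toFunctor.leftUnitor
  rightUnitor F := isoOfNatIso F.toFunctor.rightUnitor
  whiskerLeft_id F G := TotalNatTrans.ext (Functor.whiskerLeft_id' F.toFunctor)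
  whiskerLeft_comp F _ _ _ η θ := TotalNatTrans.ext (Functor.whiskerLeft_comp F.toFunctor η.nat θ.nat)
  id_whiskerLeft η := TotalNatTrans.ext (by
    ext X; exact ((Category.id_comp _).trans (Category.comp_id _)).symm)
  comp_whiskerLeft F G _ _ η := TotalNatTrans.ext (by
    ext X; exact ((Category.id_comp _).trans (Category.comp_id _)).symm)
  id_whiskerRight F G := TotalNatTrans.ext (by ext X; exact G.map_id _)
  comp_whiskerRight η θ G := TotalNatTrans.ext (by ext X; exact G.map_comp _ _)
  whiskerRight_id η := TotalNatTrans.ext (by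
    ext X; exact ((Category.id_comp _).trans (Category.comp_id _)).symm)
  whiskerRight_comp η G H := TotalNatTrans.ext (by
    ext X; exact ((Category.id_comp _).trans (Category.comp_id _)).symm)
  whisker_assoc F _ _ η H := TotalNatTrans.ext (by
    ext X; exact ((Category.id_comp _).trans (Category.comp_id _)).symm)
  whisker_exchange η θ := TotalNatTrans.ext (by ext X; exact (θ.nat.naturality _).symm)
  pentagon F G H I := TotalNatTrans.ext (by
    ext X
    exact (congrArg (fun t => t ≫ _ ≫ _) (I.map_id _)).trans (Category.id_comp _))
  triangle F G := TotalNatTrans.ext (by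
    ext X; exact (Category.id_comp _).trans (G.map_id _).symm)

instance : Bicategory.Strict SRCat.{v, u} where
  id_comp _ := rfl
  comp_id _ := rfl
  assoc _ _ _ := rfl
  leftUnitor_eqToIso _ := rfl
  rightUnitor_eqToIso _ := rfl
  associator_eqToIso _ _ _ := rfl

/-- An object `(M, v)` of the category of vector fields of a tangent split restriction category
(a tangentad of `sRCat`): `v : M ⟶ T M` is a total section of the projection. -/
structure VF (A : Tangentad SRCat.{v, max u v}) : Type (max u v) where
  M : A.X.carrier
  v : M ⟶ A.T.obj M
  total : Total v
  section_p : v ≫ A.p.nat.app M = 𝟙 M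

namespace VF

variable {A : Tangentad SRCat.{v, max u v}}

/-- A morphism `(M, v) ⟶ (N, u)`: a morphism `f : M ⟶ N` with `u ∘ f = T f ∘ v` whose
restriction idempotent commutes with `v`. -/
@[ext]
structure Hom (x y : VF A) where
  f : x.M ⟶ y.M
  comm : f ≫ y.v = x.v ≫ A.T.map f
  comm_res : res f ≫ x.v = x.v ≫ A.T.map (res f)

theorem comm_res_of_comm {x y : VF A} {f : x.M ⟶ y.M} (h : f ≫ y.v = x.v ≫ A.T.map f) :
    res f ≫ x.v = x.v ≫ A.T.map (res f) := by
  rw [A.T.map_res, RestrictionCategory.comp_res, ← h, res_comp_of_total f y.total]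

instance : Category (VF A) where
  Hom := Hom
  id x := ⟨𝟙 x.M, by rw [A.T.map_id, Category.id_comp, Category.comp_id],
    comm_res_of_comm (by rw [A.T.map_id, Category.id_comp, Category.comp_id])⟩
  comp {x y w} f g :=
    have h : (f.f ≫ g.f) ≫ w.v = x.v ≫ A.T.map (f.f ≫ g.f) := by
      rw [Category.assoc, g.comm, ← Category.assoc, f.comm, Category.assoc, ← A.T.map_comp]
    ⟨f.f ≫ g.f, h, comm_res_of_comm h⟩
  id_comp f := Hom.ext (Category.id_comp f.f)
  comp_id f := Hom.ext (Category.comp_id f.f)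
  assoc f g h := Hom.ext (Category.assoc f.f g.f h.f)

/-- The restriction structure is that of the base: the restriction idempotent of `f` is `f̄`. -/
instance : RestrictionCategory (VF A) where
  res f := ⟨res f.f, f.comm_res, by rw [res_res]; exact f.comm_res⟩
  res_comp_self f := Hom.ext (RestrictionCategory.res_comp_self f.f)
  res_comm f g := Hom.ext (RestrictionCategory.res_comm f.f g.f)
  res_res_comp f g := Hom.ext (RestrictionCategory.res_res_comp f.f g.f)
  comp_res f g := Hom.ext (RestrictionCategory.comp_res f.f g.f)

instance : SplitRestrictionCategory (VF A) where
  split {x} e he := by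
    have he' : res e.f = e.f := congrArg Hom.f he
    obtain ⟨E, r, m, h1, h2⟩ := SplitRestrictionCategory.split e.f he'
    have hr : r ≫ m ≫ r = r := by rw [h1, Category.comp_id]
    have hm : m ≫ e.f = m := by rw [← h2, ← Category.assoc, h1, Category.id_comp]
    have hp := A.p.nat.naturality r
    have hsec : (m ≫ x.v ≫ A.T.map r) ≫ A.p.nat.app E = 𝟙 E := by
      rw [Category.assoc, Category.assoc, hp]
      change m ≫ x.v ≫ A.p.nat.app x.M ≫ r = 𝟙 E
      rw [← Category.assoc x.v, x.section_p, Category.id_comp, h1]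
    let y : VF A := ⟨E, m ≫ x.v ≫ A.T.map r, total_of_comp_eq_id hsec, hsec⟩
    have hr' : r ≫ y.v = x.v ≫ A.T.map r := by
      change r ≫ m ≫ x.v ≫ A.T.map r = _
      rw [← Category.assoc, h2, ← Category.assoc, e.comm, Category.assoc, ← A.T.map_comp, ← h2,
        Category.assoc, hr]
    have hm' : m ≫ x.v = y.v ≫ A.T.map m := by
      change _ = (m ≫ x.v ≫ A.T.map r) ≫ A.T.map m
      rw [Category.assoc, Category.assoc, ← A.T.map_comp, h2, ← e.comm, ← Category.assoc, hm]
    exact ⟨y, ⟨r, hr', comm_res_of_comm (y := y) hr'⟩,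
      ⟨m, hm', comm_res_of_comm (x := y) (y := x) hm'⟩, Hom.ext h1, Hom.ext h2⟩

end VF

/-- The split restriction category `VF(X, T)`. -/
def vf (A : Tangentad SRCat.{v, max u v}) : SRCat.{v, max u v} := ⟨VF A⟩

/-- The forgetful functor `(M, v) ↦ M`. -/
def vfForget (A : Tangentad SRCat.{v, max u v}) : vf A ⟶ A.X where
  obj x := VF.M x
  map f := VF.Hom.f f
  map_id _ := rfl
  map_comp _ _ := rfl
  map_res _ := rfl

theorem section_p_vfT {A : Tangentad SRCat.{v, max u v}} (x : VF A) :
    (A.T.map x.v ≫ A.c.nat.app x.M) ≫ A.p.nat.app (A.T.obj x.M) = 𝟙 (A.T.obj x.M) := by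
  have h : A.c.nat.app x.M ≫ A.p.nat.app (A.T.obj x.M) ≫ 𝟙 _ =
      A.T.map (A.p.nat.app x.M) ≫ 𝟙 _ :=
    congrArg (fun t => t.nat.app x.M) A.str.c_p
  rw [Category.comp_id, Category.comp_id] at h
  rw [Category.assoc, h, ← A.T.map_comp, x.section_p, A.T.map_id]

theorem comm_vfT {A : Tangentad SRCat.{v, max u v}} {x y : VF A} (f : x ⟶ y) :
    A.T.map f.f ≫ A.T.map y.v ≫ A.c.nat.app y.M =
      (A.T.map x.v ≫ A.c.nat.app x.M) ≫ A.T.map (A.T.map f.f) := by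
  have h : A.T.map (A.T.map f.f) ≫ A.c.nat.app y.M = A.c.nat.app x.M ≫ A.T.map (A.T.map f.f) :=
    A.c.nat.naturality f.f
  rw [Category.assoc, ← h, ← Category.assoc, ← Category.assoc, ← A.T.map_comp, ← A.T.map_comp,
    f.comm]

/-- The tangent bundle functor `(M, v) ↦ (T M, c ∘ T v)`, `f ↦ T f`. -/
def vfT (A : Tangentad SRCat.{v, max u v}) : vf A ⟶ vf A where
  obj (x : VF A) :=
    { M := A.T.obj x.M
      v := A.T.map x.v ≫ A.c.nat.app x.M
      total := total_of_comp_eq_id (section_p_vfT x)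
      section_p := section_p_vfT x }
  map {x y} f :=
    { f := A.T.map (VF.Hom.f f)
      comm := comm_vfT f
      comm_res := by
        rw [← A.T.map_res]
        exact comm_vfT (res f) }
  map_id x := VF.Hom.ext (A.T.map_id _)
  map_comp f g := VF.Hom.ext (A.T.map_comp _ _)
  map_res f := VF.Hom.ext (A.T.map_res _)

/-- The 2-morphism `U ⟶ T ∘ U` with component `v : M ⟶ T M` at `(M, v)`. -/
def vfUniv (A : Tangentad SRCat.{v, max u v}) : vfForget A ⟶ vfForget A ≫ A.T where
  nat :=
    { app := fun x => VF.v x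
      naturality := fun _ _ f => VF.Hom.comm f }
  total x := VF.total x

theorem vfUniv_p (A : Tangentad SRCat.{v, max u v}) :
    vfUniv A ≫ vfForget A ◁ A.p ≫ (ρ_ (vfForget A)).hom = 𝟙 (vfForget A) :=
  TotalNatTrans.ext (by
    ext x
    exact (congrArg (fun t => VF.v x ≫ t) (Category.comp_id _)).trans (VF.section_p x))

/-- The tangentad consisting of `VF(X, T)` and a tangent structure `S` on it. -/
abbrev vfTangentad (A : Tangentad SRCat.{v, max u v}) (S : TangentStructure (vf A)) :
    Tangentad SRCat.{v, max u v} := ⟨vf A, S⟩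

/-- The forgetful functor `U` with the distributive law `α` and the vector field `(M, v) ↦ v`, as a
vector field of the Hom-tangent category `[VF(X, T) ‖ X, T]`. -/
def vfVectorField (A : Tangentad SRCat.{v, max u v}) (S : TangentStructure (vf A))
    (α : S.T ≫ vfForget A ⟶ vfForget A ≫ A.T)
    (hα : IsLaxLaw (A := vfTangentad A S) (B := A) α)
    (hu : α ≫ vfUniv A ▷ A.T = S.T ◁ vfUniv A ≫
      (LaxMor.tangent (A := vfTangentad A S) ⟨vfForget A, α, hα⟩).law) :
    VectorField (vfTangentad A S) A :=
  ⟨⟨vfForget A, α, hα⟩, ⟨vfUniv A, hu⟩, vfUniv_p A⟩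

end SRCat

end SRCat

end Tangentads

open Tangentads

namespace Tangentads

/-! The three universal constructions are given by explicit models. The inserter consists of pairs
of an object and a total morphism `F M ⟶ G M`, the equifier is a full subcategory, and vector fields
are treated directly on pairs `(M, v)`. In each case a 1-morphism into the model is the same data as
a 1-morphism into the base with the required extra structure, so the comparison functors are
bijective on objects and fully faithful.

The main work is the tangent structure on `VF(X, T)`. The forgetful functor `U` is faithful and
strict, so every equation between 2-morphisms descends from the base. What has to be shown is that
the structural 2-morphisms respect the vector fields, and that the pullbacks lift. For `p`, `z`,
`l`, `c` the first point is naturality combined with the identities for `c`; for `c` itself it is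
the braid equation. The vector field on an `n`-fold pullback is induced by the composites `c ∘ T v`
on its factors, since `T` preserves that pullback (`IsFold.exists_vec`); `s` then respects it by
`s_comp_map_v_c`.

`U` reflects a pullback as soon as the images of its projections under `T` are jointly monic on
total morphisms (`isFoldPullback_of_forget`, `isPullback_of_forget`). For fold pullbacks this is
preservation by iterates of `T`. The pullback of the vertical lift is not assumed to be preserved by
`T`; there the canonical flip identifies the images under `T` with the same maps at `T M`, where the
pointwise pullback applies (`map_hom_ext_of_l_universal`). -/

theorem isPullback_iff_isFoldPullback {C : Type*} [Category* C] {P E B : C} {q : E ⟶ B}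
    {π : Fin 2 → (P ⟶ E)} : IsPullback (π 0) (π 1) q q ↔ IsFoldPullback q π := by
  constructor
  · intro h
    refine ⟨fun i j => ?_, fun Z f hf => ?_⟩
    · have h0 : ∀ i : Fin 2, π i ≫ q = π 0 ≫ q := Fin.forall_fin_two.2 ⟨rfl, h.w.symm⟩
      rw [h0 i, h0 j]
    · refine ⟨h.lift (f 0) (f 1) (hf 0 1), Fin.forall_fin_two.2 ⟨h.lift_fst _ _ _, h.lift_snd _ _ _⟩,
        fun g hg => h.hom_ext ?_ ?_⟩
      · rw [h.lift_fst, hg]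
      · rw [h.lift_snd, hg]
  · intro h
    have key (s : PullbackCone q q) (i j : Fin 2) :
        ![s.fst, s.snd] i ≫ q = ![s.fst, s.snd] j ≫ q := by
      have h0 : ∀ i : Fin 2, ![s.fst, s.snd] i ≫ q = s.fst ≫ q :=
        Fin.forall_fin_two.2 ⟨rfl, s.condition.symm⟩
      rw [h0 i, h0 j]
    exact ⟨⟨h.1 0 1⟩, ⟨PullbackCone.IsLimit.mk (h.1 0 1)
      (fun s => (h.2 s.pt _ (key s)).choose)
      (fun s => (h.2 s.pt _ (key s)).choose_spec.1 0)
      (fun s => (h.2 s.pt _ (key s)).choose_spec.1 1)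
      (fun s m h0 h1 => (h.2 s.pt _ (key s)).choose_spec.2 m (Fin.forall_fin_two.2 ⟨h0, h1⟩))⟩⟩

namespace SRCat

/-! ### Total morphisms as 2-morphisms out of a point. -/

theorem hom₂_ext {X Y : SRCat.{v, u}} {F G : X ⟶ Y} {η θ : F ⟶ G}
    (h : ∀ x, η.nat.app x = θ.nat.app x) : η = θ :=
  TotalNatTrans.ext (NatTrans.ext (funext h))

/-- The split restriction category with one morphism. -/
def point : SRCat.{v, u} :=
  @SRCat.mk PUnit
    { Hom := fun _ _ => PUnit
      id := fun _ => ⟨⟩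
      comp := fun _ _ => ⟨⟩
      res := fun _ => ⟨⟩
      res_comp_self := fun _ => rfl
      res_comm := fun _ _ => rfl
      res_res_comp := fun _ _ => rfl
      comp_res := fun _ _ => rfl
      split := fun _ _ => ⟨⟨⟩, ⟨⟩, ⟨⟩, rfl, rfl⟩ }

/-- The restriction functor from the point that picks an object. -/
def pick {X : SRCat.{v, u}} (M : X.carrier) : point.{v, u} ⟶ X :=
  { obj := fun _ => M
    map := fun _ => 𝟙 M
    map_id := fun _ => rfl
    map_comp := fun _ _ => (Category.comp_id _).symm
    map_res := fun _ => (total_id M).symm : RestrictionFunctor _ _ }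

/-- A total morphism is a 2-morphism between 1-morphisms from the point. -/
def pickHom {X : SRCat.{v, u}} {F G : point.{v, u} ⟶ X} (f : F.obj ⟨⟩ ⟶ G.obj ⟨⟩) (hf : Total f) :
    F ⟶ G :=
  { nat :=
      { app := fun _ => f
        naturality := fun _ _ _ =>
          (congrArg (fun t => t ≫ f) (F.map_id ⟨⟩)).trans ((Category.id_comp f).trans
            ((Category.comp_id f).symm.trans (congrArg (fun t => f ≫ t) (G.map_id ⟨⟩).symm))) }
    total := fun _ => hf : TotalNatTrans F G }

/-! ### Componentwise identities and generalized elements of fold pullbacks. -/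

section Base

variable {A : Tangentad SRCat.{v, u}}

section Components

variable (A) (M : A.X.carrier)

/-- The component at `M` of the projection. -/
def pApp : A.T.obj M ⟶ M := A.p.nat.app M

/-- The component at `M` of the zero morphism. -/
def zApp : M ⟶ A.T.obj M := A.z.nat.app M

/-- The component at `M` of the vertical lift. -/
def lApp : A.T.obj M ⟶ A.T.obj (A.T.obj M) := A.l.nat.app M

/-- The component at `M` of the canonical flip. -/
def cApp : A.T.obj (A.T.obj M) ⟶ A.T.obj (A.T.obj M) := A.c.nat.app M

theorem total_pApp : Total (pApp A M) := A.p.total M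

theorem total_cApp : Total (cApp A M) := A.c.total M

theorem c_p_app : cApp A M ≫ pApp A (A.T.obj M) = A.T.map (pApp A M) := by
  have h : cApp A M ≫ pApp A (A.T.obj M) ≫ 𝟙 _ = A.T.map (pApp A M) ≫ 𝟙 _ :=
    congrArg (fun t => t.nat.app M) A.str.c_p
  rwa [Category.comp_id, Category.comp_id] at h

theorem c_c_app : cApp A M ≫ cApp A M = 𝟙 (A.T.obj (A.T.obj M)) :=
  congrArg (fun t => t.nat.app M) A.str.c_c

theorem c_map_p_app : cApp A M ≫ A.T.map (pApp A M) = pApp A (A.T.obj M) := by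
  rw [← c_p_app, reassoc_of% c_c_app]

theorem map_z_c_app : A.T.map (zApp A M) ≫ cApp A M = zApp A (A.T.obj M) := by
  have h : 𝟙 _ ≫ A.T.map (zApp A M) ≫ cApp A M = 𝟙 _ ≫ zApp A (A.T.obj M) :=
    congrArg (fun t => t.nat.app M) A.str.z_c
  rwa [Category.id_comp, Category.id_comp] at h

theorem z_c_app : zApp A (A.T.obj M) ≫ cApp A M = A.T.map (zApp A M) := by
  rw [← map_z_c_app, Category.assoc, c_c_app, Category.comp_id]

theorem l_c_c_app : lApp A (A.T.obj M) ≫ A.T.map (cApp A M) ≫ cApp A (A.T.obj M) =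
    cApp A M ≫ A.T.map (lApp A M) := by
  have h : lApp A (A.T.obj M) ≫ 𝟙 _ ≫ A.T.map (cApp A M) ≫ 𝟙 _ ≫
      cApp A (A.T.obj M) = cApp A M ≫ A.T.map (lApp A M) ≫ 𝟙 _ :=
    congrArg (fun t => t.nat.app M) A.str.l_c_c
  rwa [Category.id_comp, Category.id_comp, Category.comp_id] at h

theorem map_l_c_c_app : A.T.map (lApp A M) ≫ cApp A (A.T.obj M) ≫ A.T.map (cApp A M) =
    cApp A M ≫ lApp A (A.T.obj M) := by
  have h := congrArg (fun t => cApp A M ≫ t) (l_c_c_app A M)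
  simp only [reassoc_of% c_c_app] at h
  rw [← h, Category.assoc, Category.assoc, Category.assoc, reassoc_of% c_c_app, ← A.T.map_comp, c_c_app,
    A.T.map_id, Category.comp_id]

theorem c_braid_app : A.T.map (cApp A M) ≫ cApp A (A.T.obj M) ≫ A.T.map (cApp A M) =
    cApp A (A.T.obj M) ≫ A.T.map (cApp A M) ≫ cApp A (A.T.obj M) := by
  have h : A.T.map (cApp A M) ≫ 𝟙 _ ≫ cApp A (A.T.obj M) ≫ 𝟙 _ ≫
      A.T.map (cApp A M) = 𝟙 _ ≫ cApp A (A.T.obj M) ≫ 𝟙 _ ≫ A.T.map (cApp A M) ≫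
        𝟙 _ ≫ cApp A (A.T.obj M) ≫ 𝟙 _ :=
    congrArg (fun t => t.nat.app M) A.str.c_braid
  simpa only [Category.id_comp, Category.comp_id] using h

theorem map_map_c {M N : A.X.carrier} (f : M ⟶ N) :
    A.T.map (A.T.map f) ≫ cApp A N = cApp A M ≫ A.T.map (A.T.map f) :=
  A.c.nat.naturality f

theorem p_naturality {M N : A.X.carrier} (f : M ⟶ N) :
    A.T.map f ≫ pApp A N = pApp A M ≫ f :=
  A.p.nat.naturality f

theorem z_naturality {M N : A.X.carrier} (f : M ⟶ N) :
    f ≫ zApp A N = zApp A M ≫ A.T.map f :=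
  A.z.nat.naturality f

theorem l_naturality {M N : A.X.carrier} (f : M ⟶ N) :
    A.T.map f ≫ lApp A N = lApp A M ≫ A.T.map (A.T.map f) :=
  A.l.nat.naturality f

end Components

/-- The `π i : P ⟶ T` exhibit `P` as the pointwise `n`-fold pullback of the projection, preserved
by all iterates of `T`. -/
def IsFold (A : Tangentad SRCat.{v, u}) {n : ℕ} {P : A.X ⟶ A.X} (π : Fin n → (P ⟶ A.T)) : Prop :=
  ∀ (Y : SRCat.{v, u}) (F : Y ⟶ A.X) (m : ℕ),
    IsFoldPullback (F ◁ A.p ▷ iter A.T m) (fun i => F ◁ π i ▷ iter A.T m)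

theorem isFold_T₂ (A : Tangentad SRCat.{v, u}) : IsFold A ![A.str.π₁, A.str.π₂] :=
  fun _ F m => isPullback_iff_isFoldPullback.1 (A.str.isPullback F m)

namespace IsFold

variable {n : ℕ} {P : A.X ⟶ A.X} {π : Fin n → (P ⟶ A.T)}

/-- Probing the pointwise pullback with the one-point category turns 2-morphisms into total
morphisms of `X`. This is why joint monicity is obtained only against total morphisms. -/
theorem hom_ext_iter (h : IsFold A π) (m : ℕ) {M W : A.X.carrier}
    {x y : W ⟶ (iter A.T m).obj (P.obj M)} (hx : Total x) (hy : Total y)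
    (e : ∀ i, x ≫ (iter A.T m).map ((π i).nat.app M) = y ≫ (iter A.T m).map ((π i).nat.app M)) :
    x = y := by
  have h1 := h point (pick M) m
  have h2 := h1.2 (pick W)
    (fun i => pickHom (F := pick W) (G := pick M ≫ P ≫ iter A.T m) x hx ≫
      pick M ◁ π i ▷ iter A.T m) (fun i j => by rw [Category.assoc, Category.assoc, h1.1 i j])
  have h3 := h2.unique (y₁ := pickHom (F := pick W) (G := pick M ≫ P ≫ iter A.T m) x hx)
    (y₂ := pickHom (F := pick W) (G := pick M ≫ P ≫ iter A.T m) y hy) (fun i => rfl)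
    (fun i => hom₂_ext fun _ => (e i).symm)
  exact congrArg (fun t => t.nat.app ⟨⟩) h3

theorem hom_ext (h : IsFold A π) {M W : A.X.carrier} {x y : W ⟶ P.obj M} (hx : Total x)
    (hy : Total y) (e : ∀ i, x ≫ (π i).nat.app M = y ≫ (π i).nat.app M) : x = y :=
  h.hom_ext_iter 0 hx hy e

theorem map_hom_ext (h : IsFold A π) {M W : A.X.carrier} {x y : W ⟶ A.T.obj (P.obj M)}
    (hx : Total x) (hy : Total y)
    (e : ∀ i, x ≫ A.T.map ((π i).nat.app M) = y ≫ A.T.map ((π i).nat.app M)) : x = y :=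
  h.hom_ext_iter 1 hx hy e

theorem exists_lift (h : IsFold A π) {M W : A.X.carrier} (f : Fin n → (W ⟶ A.T.obj M))
    (hf : ∀ i, Total (f i)) (e : ∀ i j, f i ≫ pApp A M = f j ≫ pApp A M) :
    ∃ g : W ⟶ P.obj M, Total g ∧ ∀ i, g ≫ (π i).nat.app M = f i := by
  obtain ⟨g, hg, -⟩ := (h point (pick M) 0).2 (pick W)
    (fun i => pickHom (F := pick W) (G := pick M ≫ A.T ≫ iter A.T 0) (f i) (hf i))
    (fun i j => hom₂_ext fun _ => e i j)
  exact ⟨g.nat.app ⟨⟩, g.total ⟨⟩, fun i => congrArg (fun t => t.nat.app ⟨⟩) (hg i)⟩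

theorem comp_p (h : IsFold A π) (i j : Fin n) (M : A.X.carrier) :
    (π i).nat.app M ≫ pApp A M = (π j).nat.app M ≫ pApp A M :=
  congrArg (fun t => t.nat.app ⟨⟩) ((h point (pick M) 0).1 i j)

end IsFold

/-- The components of the canonical comparison `T T₂ ⟶ T₂ T`. -/
theorem exists_flip₂ (A : Tangentad SRCat.{v, u}) (M : A.X.carrier) :
    ∃ a : A.T.obj (A.T₂.obj M) ⟶ A.T₂.obj (A.T.obj M), Total a ∧
      (∀ i, a ≫ (![A.str.π₁, A.str.π₂] i).nat.app (A.T.obj M) =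
        A.T.map ((![A.str.π₁, A.str.π₂] i).nat.app M) ≫ cApp A M) ∧
      A.T.map (A.s.nat.app M) ≫ cApp A M = a ≫ A.s.nat.app (A.T.obj M) := by
  obtain ⟨a, h1, h2, h3⟩ := A.str.s_c
  exact ⟨a.nat.app M, a.total M, Fin.forall_fin_two.2 ⟨congrArg (fun t => t.nat.app M) h1,
    congrArg (fun t => t.nat.app M) h2⟩, congrArg (fun t => t.nat.app M) h3⟩

/-- Associativity of the sum for generalized elements. -/
theorem s_assoc_app {M W : A.X.carrier} {a b d e : W ⟶ A.T₂.obj M} (ha : Total a) (hb : Total b)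
    (hd : Total d) (he : Total e)
    (hab : a ≫ A.str.π₂.nat.app M = b ≫ A.str.π₁.nat.app M)
    (hd₁ : d ≫ A.str.π₁.nat.app M = a ≫ A.s.nat.app M)
    (hd₂ : d ≫ A.str.π₂.nat.app M = b ≫ A.str.π₂.nat.app M)
    (he₁ : e ≫ A.str.π₁.nat.app M = a ≫ A.str.π₁.nat.app M)
    (he₂ : e ≫ A.str.π₂.nat.app M = b ≫ A.s.nat.app M) :
    d ≫ A.s.nat.app M = e ≫ A.s.nat.app M := by
  -- The axiom `s_assoc` speaks only of 2-morphisms between endomorphisms of `X`. It is applied to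
  -- the universal composable pair `a₀ = ⟨π 0, π 1⟩`, `b₀ = ⟨π 1, π 2⟩` on the 3-fold pullback, and
  -- the given pair is a pullback of that one along `g`.
  obtain ⟨P, π, h⟩ := A.str.exists_foldPullback 3 (by norm_num)
  have hP : IsFold A π := fun _ F m => h F m
  have hT := isFold_T₂ A
  have hpb := A.str.isPullback (𝟙 A.X) 0
  let a₀ : P ⟶ A.T₂ := hpb.lift (π 0) (π 1) ((hP _ (𝟙 A.X) 0).1 0 1)
  let b₀ : P ⟶ A.T₂ := hpb.lift (π 1) (π 2) ((hP _ (𝟙 A.X) 0).1 1 2)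
  have ha₁ : a₀ ≫ A.str.π₁ = π 0 := hpb.lift_fst _ _ _
  have ha₂ : a₀ ≫ A.str.π₂ = π 1 := hpb.lift_snd _ _ _
  have hb₁ : b₀ ≫ A.str.π₁ = π 1 := hpb.lift_fst _ _ _
  have hb₂ : b₀ ≫ A.str.π₂ = π 2 := hpb.lift_snd _ _ _
  obtain ⟨d₀, e₀, h1, h2, h3, h4, h5⟩ := A.str.s_assoc a₀ b₀ (ha₂.trans hb₁.symm)
  have app {F G : A.X ⟶ A.X} {η θ : F ⟶ G} (h : η = θ) : η.nat.app M = θ.nat.app M := h ▸ rfl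
  have ha₁' : a₀.nat.app M ≫ A.str.π₁.nat.app M = (π 0).nat.app M := app ha₁
  have ha₂' : a₀.nat.app M ≫ A.str.π₂.nat.app M = (π 1).nat.app M := app ha₂
  have hb₁' : b₀.nat.app M ≫ A.str.π₁.nat.app M = (π 1).nat.app M := app hb₁
  have hb₂' : b₀.nat.app M ≫ A.str.π₂.nat.app M = (π 2).nat.app M := app hb₂
  have h1' : d₀.nat.app M ≫ A.str.π₁.nat.app M = a₀.nat.app M ≫ A.s.nat.app M := app h1
  have h2' : d₀.nat.app M ≫ A.str.π₂.nat.app M = b₀.nat.app M ≫ A.str.π₂.nat.app M := app h2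
  have h3' : e₀.nat.app M ≫ A.str.π₁.nat.app M = a₀.nat.app M ≫ A.str.π₁.nat.app M := app h3
  have h4' : e₀.nat.app M ≫ A.str.π₂.nat.app M = b₀.nat.app M ≫ A.s.nat.app M := app h4
  have h5' : d₀.nat.app M ≫ A.s.nat.app M = e₀.nat.app M ≫ A.s.nat.app M := app h5
  have hp : A.str.π₁.nat.app M ≫ pApp A M = A.str.π₂.nat.app M ≫ pApp A M :=
    hT.comp_p 0 1 M
  obtain ⟨g, hg, hgπ⟩ := hP.exists_lift
    (M := M) (W := W)
    ![a ≫ A.str.π₁.nat.app M, a ≫ A.str.π₂.nat.app M, b ≫ A.str.π₂.nat.app M]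
    (by
      intro i
      fin_cases i
      · exact ha.comp (A.str.π₁.total M)
      · exact ha.comp (A.str.π₂.total M)
      · exact hb.comp (A.str.π₂.total M))
    (by
      have key : ∀ i, ![a ≫ A.str.π₁.nat.app M, a ≫ A.str.π₂.nat.app M,
          b ≫ A.str.π₂.nat.app M] i ≫ pApp A M = a ≫ A.str.π₂.nat.app M ≫ pApp A M := by
        intro i
        fin_cases i
        · exact (Category.assoc _ _ _).trans (congrArg (fun t => a ≫ t) hp)
        · exact Category.assoc _ _ _
        · change (b ≫ _) ≫ _ = _
          rw [Category.assoc, ← hp, ← Category.assoc, ← hab, Category.assoc, hp]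
      intro i j
      rw [key i, key j])
  have hg0 : g ≫ (π 0).nat.app M = a ≫ A.str.π₁.nat.app M := hgπ 0
  have hg1 : g ≫ (π 1).nat.app M = a ≫ A.str.π₂.nat.app M := hgπ 1
  have hg2 : g ≫ (π 2).nat.app M = b ≫ A.str.π₂.nat.app M := hgπ 2
  have ea : g ≫ a₀.nat.app M = a := hT.hom_ext (hg.comp (a₀.total M)) ha
    (Fin.forall_fin_two.2 ⟨by
      change (g ≫ _) ≫ A.str.π₁.nat.app M = a ≫ A.str.π₁.nat.app M
      rw [Category.assoc, ha₁', hg0], by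
      change (g ≫ _) ≫ A.str.π₂.nat.app M = a ≫ A.str.π₂.nat.app M
      rw [Category.assoc, ha₂', hg1]⟩)
  have eb : g ≫ b₀.nat.app M = b := hT.hom_ext (hg.comp (b₀.total M)) hb
    (Fin.forall_fin_two.2 ⟨by
      change (g ≫ _) ≫ A.str.π₁.nat.app M = b ≫ A.str.π₁.nat.app M
      rw [Category.assoc, hb₁', hg1, hab], by
      change (g ≫ _) ≫ A.str.π₂.nat.app M = b ≫ A.str.π₂.nat.app M
      rw [Category.assoc, hb₂', hg2]⟩)
  have ed : g ≫ d₀.nat.app M = d := hT.hom_ext (hg.comp (d₀.total M)) hd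
    (Fin.forall_fin_two.2 ⟨by
      change (g ≫ _) ≫ A.str.π₁.nat.app M = d ≫ A.str.π₁.nat.app M
      rw [Category.assoc, h1', ← Category.assoc, ea, hd₁], by
      change (g ≫ _) ≫ A.str.π₂.nat.app M = d ≫ A.str.π₂.nat.app M
      rw [Category.assoc, h2', ← Category.assoc, eb, hd₂]⟩)
  have ee : g ≫ e₀.nat.app M = e := hT.hom_ext (hg.comp (e₀.total M)) he
    (Fin.forall_fin_two.2 ⟨by
      change (g ≫ _) ≫ A.str.π₁.nat.app M = e ≫ A.str.π₁.nat.app M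
      rw [Category.assoc, h3', ← Category.assoc, ea, he₁], by
      change (g ≫ _) ≫ A.str.π₂.nat.app M = e ≫ A.str.π₂.nat.app M
      rw [Category.assoc, h4', ← Category.assoc, eb, he₂]⟩)
  rw [← ed, ← ee, Category.assoc, Category.assoc, h5']

end Base

/-! ### Morphisms into `VF(X, T)` and reflection of pullbacks by the forgetful functor. -/

section Lift

variable {A : Tangentad SRCat.{v, max u v}} {Y : SRCat.{v, max u v}}

theorem vf_hom₂_ext {H H' : Y ⟶ vf A} {η θ : H ⟶ H'}
    (h : ∀ y, VF.Hom.f (η.nat.app y) = VF.Hom.f (θ.nat.app y)) : η = θ :=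
  hom₂_ext fun y => VF.Hom.ext (h y)

/-- The 1-morphism into `VF(X, T)` induced by a section of the projection. -/
def vfLift (F : Y ⟶ A.X) (w : F ⟶ F ≫ A.T)
    (hw : ∀ y, w.nat.app y ≫ pApp A (F.obj y) = 𝟙 (F.obj y)) : Y ⟶ vf A :=
  { obj := fun y => (⟨F.obj y, w.nat.app y, w.total y, hw y⟩ : VF A)
    map := fun {y y'} f => (⟨F.map f, w.nat.naturality f,
      VF.comm_res_of_comm (x := ⟨F.obj y, w.nat.app y, w.total y, hw y⟩)
        (y := ⟨F.obj y', w.nat.app y', w.total y', hw y'⟩) (w.nat.naturality f)⟩ : VF.Hom _ _)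
    map_id := fun y => VF.Hom.ext (F.map_id y)
    map_comp := fun f g => VF.Hom.ext (F.map_comp f g)
    map_res := fun f => VF.Hom.ext (F.map_res f) : RestrictionFunctor _ _ }

/-- The 2-morphism between 1-morphisms into `VF(X, T)` induced by a 2-morphism in the base that is
compatible with the vector fields. -/
def vfLift₂ {H H' : Y ⟶ vf A} (φ : H ≫ vfForget A ⟶ H' ≫ vfForget A)
    (h : ∀ y, φ.nat.app y ≫ VF.v (H'.obj y) = VF.v (H.obj y) ≫ A.T.map (φ.nat.app y)) : H ⟶ H' :=
  { nat :=
      { app := fun y => (⟨φ.nat.app y, h y, VF.comm_res_of_comm (x := H.obj y) (y := H'.obj y) (h y)⟩ :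
          VF.Hom _ _)
        naturality := fun _ _ f => VF.Hom.ext (φ.nat.naturality f) }
    total := fun y => VF.Hom.ext (φ.total y) : TotalNatTrans H H' }

/-- Compatibility with the vector fields can be tested on a family of morphisms whose image under
`T` is jointly monic on total morphisms. -/
theorem VF.comm_of_jointlyMono {x y : VF A} {ι : Type*} {E : ι → VF A} (q : ∀ i, y ⟶ E i)
    (hq : ∀ {W : A.X.carrier} {a b : W ⟶ A.T.obj y.M}, Total a → Total b →
      (∀ i, a ≫ A.T.map (VF.Hom.f (q i)) = b ≫ A.T.map (VF.Hom.f (q i))) → a = b)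
    {a : x.M ⟶ y.M} (ha : Total a) (b : ∀ i, x ⟶ E i)
    (h : ∀ i, a ≫ VF.Hom.f (q i) = VF.Hom.f (b i)) : a ≫ y.v = x.v ≫ A.T.map a := by
  refine hq (ha.comp y.total) (x.total.comp (A.T.total_map ha)) fun i => ?_
  have h1 := (b i).comm
  rw [← h, Category.assoc, (q i).comm, A.T.map_comp] at h1
  rw [Category.assoc, h1, Category.assoc]

/-- The forgetful functor reflects fold pullbacks whose projections stay jointly monic under `T`. -/
theorem isFoldPullback_of_forget {n : ℕ} {D E B : Y ⟶ vf A} (q : E ⟶ B) (π : Fin n → (D ⟶ E))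
    (hU : IsFoldPullback (q ▷ vfForget A) (fun i => π i ▷ vfForget A))
    (hm : ∀ (y : Y.carrier) {W : A.X.carrier} {a b : W ⟶ A.T.obj (VF.M (D.obj y))},
      Total a → Total b → (∀ i, a ≫ A.T.map (VF.Hom.f ((π i).nat.app y)) =
        b ≫ A.T.map (VF.Hom.f ((π i).nat.app y))) → a = b) :
    IsFoldPullback q π := by
  refine ⟨fun i j => vf_hom₂_ext fun y => congrArg (fun t => t.nat.app y) (hU.1 i j),
    fun Z f hf => ?_⟩
  obtain ⟨g, hg, hg'⟩ := hU.2 (Z ≫ vfForget A) (fun i => f i ▷ vfForget A)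
    (fun i j => congrArg (fun t => t ▷ vfForget A) (hf i j))
  have e (i) (y) : g.nat.app y ≫ VF.Hom.f ((π i).nat.app y) = VF.Hom.f ((f i).nat.app y) :=
    congrArg (fun t => t.nat.app y) (hg i)
  -- The comparison is the one of the base. It respects the vector fields because its composites
  -- with the projections do, and these stay jointly monic under `T`.
  refine ⟨vfLift₂ g fun y => VF.comm_of_jointlyMono (x := Z.obj y) (y := D.obj y)
    (fun i => (π i).nat.app y) (hm y) (g.total y) (fun i => (f i).nat.app y) (fun i => e i y),
    fun i => vf_hom₂_ext (e i), fun g₁ h₁ => vf_hom₂_ext fun y => ?_⟩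
  exact congrArg (fun t => t.nat.app y)
    (hg' (g₁ ▷ vfForget A) fun i => congrArg (fun t => t ▷ vfForget A) (h₁ i))

/-- The forgetful functor reflects pullbacks whose projections stay jointly monic under `T`. -/
theorem isPullback_of_forget {D E E' B : Y ⟶ vf A} {π : D ⟶ E} {π' : D ⟶ E'} {q : E ⟶ B}
    {q' : E' ⟶ B}
    (hU : IsPullback (π ▷ vfForget A) (π' ▷ vfForget A) (q ▷ vfForget A) (q' ▷ vfForget A))
    (hm : ∀ (y : Y.carrier) {W : A.X.carrier} {a b : W ⟶ A.T.obj (VF.M (D.obj y))},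
      Total a → Total b →
      a ≫ A.T.map (VF.Hom.f (π.nat.app y)) = b ≫ A.T.map (VF.Hom.f (π.nat.app y)) →
      a ≫ A.T.map (VF.Hom.f (π'.nat.app y)) = b ≫ A.T.map (VF.Hom.f (π'.nat.app y)) → a = b) :
    IsPullback π π' q q' := by
  have hw : π ≫ q = π' ≫ q' := vf_hom₂_ext fun y => congrArg (fun t => t.nat.app y) hU.w
  have key (s : PullbackCone q q') : ∃ g : s.pt ⟶ D, g ≫ π = s.fst ∧ g ≫ π' = s.snd := by
    let g := hU.lift (s.fst ▷ vfForget A) (s.snd ▷ vfForget A)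
      (congrArg (fun t => t ▷ vfForget A) s.condition)
    have hg : g ≫ π ▷ vfForget A = s.fst ▷ vfForget A := hU.lift_fst _ _ _
    have hg' : g ≫ π' ▷ vfForget A = s.snd ▷ vfForget A := hU.lift_snd _ _ _
    have e (y) : g.nat.app y ≫ VF.Hom.f (π.nat.app y) = VF.Hom.f (s.fst.nat.app y) :=
      congrArg (fun t => t.nat.app y) hg
    have e' (y) : g.nat.app y ≫ VF.Hom.f (π'.nat.app y) = VF.Hom.f (s.snd.nat.app y) :=
      congrArg (fun t => t.nat.app y) hg'
    -- The two projections have different codomains, so they form a dependent family over `Bool`,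
    -- with `true` standing for `π` and `false` for `π'`.
    refine ⟨vfLift₂ g fun y => VF.comm_of_jointlyMono (x := s.pt.obj y) (y := D.obj y)
      (E := fun b : Bool => (b.rec (E'.obj y) (E.obj y) : VF A))
      (fun b => b.rec (π'.nat.app y) (π.nat.app y))
      (fun ha hb h => hm y ha hb (h true) (h false)) (g.total y)
      (fun b => b.rec (s.snd.nat.app y) (s.fst.nat.app y)) (Bool.rec (e' y) (e y)),
      vf_hom₂_ext e, vf_hom₂_ext e'⟩
  refine ⟨⟨hw⟩, ⟨PullbackCone.IsLimit.mk hw (fun s => (key s).choose)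
    (fun s => (key s).choose_spec.1) (fun s => (key s).choose_spec.2) fun s m h h' => ?_⟩⟩
  have h1 : m ▷ vfForget A = (key s).choose ▷ vfForget A := hU.hom_ext
    (congrArg (fun t => t ▷ vfForget A) (h.trans (key s).choose_spec.1.symm))
    (congrArg (fun t => t ▷ vfForget A) (h'.trans (key s).choose_spec.2.symm))
  exact vf_hom₂_ext fun y => congrArg (fun t => t.nat.app y) h1

variable (A)

/-- For a variable `m` this equality of 1-morphisms is not definitional. Later statements therefore
take a 1-morphism `K` with an equation `K = vfForget A ≫ iter A.T m` and substitute, which avoids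
transporting 2-morphisms along it. -/
theorem iter_vfT_forget (m : ℕ) :
    iter (vfT A) m ≫ vfForget A = vfForget A ≫ iter A.T m := by
  induction m with
  | zero => rfl
  | succ m ih => exact congrArg (fun K => K ≫ A.T) ih

theorem vf_v_p (x : VF A) : x.v ≫ pApp A x.M = 𝟙 x.M := x.section_p

/-- The projection of `VF(X, T)`. -/
def vfP : vfT A ⟶ 𝟙 (vf A) :=
  vfLift₂ (H := vfT A) (H' := 𝟙 (vf A)) (vfForget A ◁ A.p) fun x => by
    change pApp A (VF.M x) ≫ VF.v x = (A.T.map (VF.v x) ≫ cApp A (VF.M x)) ≫ A.T.map (pApp A (VF.M x))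
    rw [Category.assoc, c_map_p_app, p_naturality]

end Lift

/-! ### Fold pullbacks of the projection of `VF(X, T)`. -/

section Fold

variable {A : Tangentad SRCat.{v, max u v}} {n : ℕ} {P : A.X ⟶ A.X} {π : Fin n → (P ⟶ A.T)}

/-- The universal property is used at the forgetful functor with `m = 1`. The family to be lifted is
compatible because `c ∘ T v` followed by `T p` equals `v ∘ p`, and all `p ∘ π i` agree. Lifting at
the level of 2-morphisms yields naturality and totality of the new vector field at once. -/
theorem IsFold.exists_vec (h : IsFold A π) :
    ∃ w : vfForget A ≫ P ⟶ (vfForget A ≫ P) ≫ A.T, ∀ (i : Fin n) (x : VF A),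
      w.nat.app x ≫ A.T.map ((π i).nat.app x.M) =
        (π i).nat.app x.M ≫ A.T.map x.v ≫ cApp A x.M := by
  obtain ⟨w, hw, -⟩ := (h _ (vfForget A) 1).2 (vfForget A ≫ P)
    (fun i => vfForget A ◁ π i ≫ vfUniv A ▷ A.T ≫ vfForget A ◁ A.c) (fun i j => hom₂_ext fun x => by
      change ((π i).nat.app (VF.M x) ≫ A.T.map (VF.v x) ≫ cApp A (VF.M x)) ≫
        A.T.map (pApp A (VF.M x)) = ((π j).nat.app (VF.M x) ≫ A.T.map (VF.v x) ≫ cApp A (VF.M x)) ≫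
        A.T.map (pApp A (VF.M x))
      have hp : (π i).nat.app (VF.M x) ≫ pApp A (VF.M x) = (π j).nat.app (VF.M x) ≫ pApp A (VF.M x) :=
        h.comp_p i j _
      simp only [Category.assoc, c_map_p_app, p_naturality]
      rw [← Category.assoc, hp, Category.assoc])
  exact ⟨w, fun i x => congrArg (fun t => t.nat.app x) (hw i)⟩

/-- The vector field on the fold pullback of `T` induced by those on `T`. -/
noncomputable def IsFold.vec (h : IsFold A π) : vfForget A ≫ P ⟶ (vfForget A ≫ P) ≫ A.T :=
  h.exists_vec.choose

/-- The component of `IsFold.vec`. -/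
noncomputable def IsFold.vecApp (h : IsFold A π) (x : VF A) : P.obj x.M ⟶ A.T.obj (P.obj x.M) :=
  h.vec.nat.app x

theorem IsFold.vecApp_map_π (h : IsFold A π) (i : Fin n) (x : VF A) :
    h.vecApp x ≫ A.T.map ((π i).nat.app x.M) =
      (π i).nat.app x.M ≫ A.T.map x.v ≫ cApp A x.M :=
  h.exists_vec.choose_spec i x

theorem IsFold.total_vecApp (h : IsFold A π) (x : VF A) : Total (h.vecApp x) := h.vec.total x

/-- After each projection the claim reduces to `c ∘ T v` being a section of `p_T`, which is `T`
applied to the section property of `v`. -/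
theorem IsFold.vecApp_p (h : IsFold A π) (x : VF A) :
    h.vecApp x ≫ pApp A (P.obj x.M) = 𝟙 (P.obj x.M) := by
  refine h.hom_ext ((h.total_vecApp x).comp (total_pApp A _)) (total_id _) fun i => ?_
  rw [Category.assoc, ← p_naturality, reassoc_of% (h.vecApp_map_π i x), c_p_app, ← A.T.map_comp, vf_v_p,
    A.T.map_id, Category.comp_id, Category.id_comp]

/-- The fold pullback of the projection of `VF(X, T)`. -/
noncomputable def vfFold (h : IsFold A π) : vf A ⟶ vf A :=
  vfLift (vfForget A ≫ P) h.vec h.vecApp_p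

/-- The projections of the fold pullback of the projection of `VF(X, T)`. -/
noncomputable def vfFoldπ (h : IsFold A π) (i : Fin n) : vfFold h ⟶ vfT A :=
  vfLift₂ (H := vfFold h) (H' := vfT A) (vfForget A ◁ π i) fun x => (h.vecApp_map_π i x).symm

theorem vfFold_map_hom_ext (h : IsFold A π) {m : ℕ} {K : vf A ⟶ A.X}
    (hK : K = vfForget A ≫ iter A.T m) (x : VF A) {W : A.X.carrier}
    {a b : W ⟶ K.obj ((vfFold h).obj x)} (ha : Total a) (hb : Total b)
    (e : ∀ i, a ≫ K.map ((vfFoldπ h i).nat.app x) = b ≫ K.map ((vfFoldπ h i).nat.app x)) :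
    a = b := by
  subst hK
  exact h.hom_ext_iter (M := x.M) m ha hb e

theorem isFoldPullback_vfFold (h : IsFold A π) {Y : SRCat.{v, max u v}} (F : Y ⟶ vf A) (m : ℕ) :
    IsFoldPullback (F ◁ vfP A ▷ iter (vfT A) m) (fun i => F ◁ vfFoldπ h i ▷ iter (vfT A) m) := by
  refine isFoldPullback_of_forget _ _ ?_ ?_
  · have aux {K : vf A ⟶ A.X} (hK : K = vfForget A ≫ iter A.T m) :
        IsFoldPullback (F ◁ vfP A ▷ K) (fun i => F ◁ vfFoldπ h i ▷ K) := by
      subst hK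
      exact h _ (F ≫ vfForget A) m
    exact aux (iter_vfT_forget A m)
  · intro y W a b ha hb e
    -- Reflection requires joint monicity after one further application of `T`, hence the exponent
    -- `m + 1`.
    exact vfFold_map_hom_ext h (m := m + 1) (K := (iter (vfT A) m ≫ vfForget A) ≫ A.T)
      (congrArg (fun K => K ≫ A.T) (iter_vfT_forget A m)) (F.obj y) ha hb e

end Fold

theorem app_congr {X Y : SRCat.{v, u}} {F G : X ⟶ Y} {η θ : F ⟶ G} (h : η = θ) (x : X.carrier) :
    η.nat.app x = θ.nat.app x := h ▸ rfl

/-! ### Joint monicity under `T` for the universality of the vertical lift. -/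

section Vertical

variable {A : Tangentad SRCat.{v, u}} {a : A.T₂ ⟶ A.T₂ ≫ A.T}

/-- The maps that express the universality of the vertical lift stay jointly monic under `T`. -/
theorem map_hom_ext_of_l_universal (h₁ : a ≫ A.str.π₁ ▷ A.T = A.str.π₁ ≫ A.l)
    (h₂ : a ≫ A.str.π₂ ▷ A.T = A.str.π₂ ≫ (ρ_ A.T).inv ≫ A.T ◁ A.z)
    (h : ∀ {Y : SRCat.{v, u}} (F : Y ⟶ A.X), IsPullback (F ◁ (a ≫ A.s ▷ A.T))
      (F ◁ (A.str.π₁ ≫ A.p)) (F ◁ (A.p ▷ A.T ≫ (λ_ A.T).hom)) (F ◁ A.z))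
    {M W : A.X.carrier} {x y : W ⟶ A.T.obj (A.T₂.obj M)} (hx : Total x) (hy : Total y)
    (e₁ : x ≫ A.T.map (a.nat.app M ≫ A.T.map (A.s.nat.app M)) =
      y ≫ A.T.map (a.nat.app M ≫ A.T.map (A.s.nat.app M)))
    (e₂ : x ≫ A.T.map (A.str.π₁.nat.app M ≫ pApp A M) =
      y ≫ A.T.map (A.str.π₁.nat.app M ≫ pApp A M)) : x = y := by
  have hT := isFold_T₂ A
  -- The pointwise pullback at an object `N`; it is used below only for `N = T M`.
  have mono {N : A.X.carrier} {s t : W ⟶ A.T₂.obj N} (hs : Total s) (ht : Total t)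
      (e₁ : s ≫ a.nat.app N ≫ A.T.map (A.s.nat.app N) =
        t ≫ a.nat.app N ≫ A.T.map (A.s.nat.app N))
      (e₂ : s ≫ A.str.π₁.nat.app N ≫ pApp A N = t ≫ A.str.π₁.nat.app N ≫ pApp A N) : s = t :=
    congrArg (fun t => t.nat.app ⟨⟩) ((h (pick N)).hom_ext
      (k := pickHom (F := pick W) (G := pick N ≫ A.T₂) s hs)
      (l := pickHom (F := pick W) (G := pick N ≫ A.T₂) t ht)
      (hom₂_ext fun _ => e₁) (hom₂_ext fun _ => e₂))
  obtain ⟨k, hk, hkπ, hks⟩ := exists_flip₂ A M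
  have ha₁ (N : A.X.carrier) : a.nat.app N ≫ A.T.map (A.str.π₁.nat.app N) =
      A.str.π₁.nat.app N ≫ lApp A N := app_congr h₁ N
  have ha₂ (N : A.X.carrier) : a.nat.app N ≫ A.T.map (A.str.π₂.nat.app N) =
      A.str.π₂.nat.app N ≫ zApp A (A.T.obj N) :=
    (app_congr h₂ N).trans (congrArg (fun t => A.str.π₂.nat.app N ≫ t) (Category.id_comp _))
  have hk₁ : k ≫ A.str.π₁.nat.app (A.T.obj M) = A.T.map (A.str.π₁.nat.app M) ≫ cApp A M := hkπ 0
  have hk₂ : k ≫ A.str.π₂.nat.app (A.T.obj M) = A.T.map (A.str.π₂.nat.app M) ≫ cApp A M := hkπ 1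
  have ta (N : A.X.carrier) : Total (X := A.T₂.obj N) (Y := A.T.obj (A.T₂.obj N)) (a.nat.app N) :=
    a.total N
  -- The flip `k : T T₂ ⟶ T₂ T` intertwines `T a` with `a` at `T M`. This is tested on the two
  -- projections, where `a` becomes the vertical lift and the zero, and both are compatible with
  -- `c`.
  have key : A.T.map (a.nat.app M) ≫ cApp A (A.T₂.obj M) ≫ A.T.map k =
      k ≫ a.nat.app (A.T.obj M) := by
    refine hT.map_hom_ext ((A.T.total_map (ta M)).comp ((total_cApp A _).comp (A.T.total_map hk)))
      (hk.comp (ta _)) (Fin.forall_fin_two.2 ⟨?_, ?_⟩)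
    · change (_ ≫ _ ≫ _) ≫ A.T.map (A.str.π₁.nat.app _) = (k ≫ a.nat.app _) ≫
        A.T.map (A.str.π₁.nat.app _)
      rw [Category.assoc, Category.assoc, Category.assoc, ← A.T.map_comp, hk₁, ha₁, A.T.map_comp,
        ← reassoc_of% map_map_c, ← A.T.map_comp_assoc, ha₁, A.T.map_comp, Category.assoc,
        map_l_c_c_app, reassoc_of% hk₁]
    · change (_ ≫ _ ≫ _) ≫ A.T.map (A.str.π₂.nat.app _) = (k ≫ a.nat.app _) ≫
        A.T.map (A.str.π₂.nat.app _)
      rw [Category.assoc, Category.assoc, Category.assoc, ← A.T.map_comp, hk₂, ha₂, A.T.map_comp,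
        ← reassoc_of% map_map_c, ← A.T.map_comp_assoc, ha₂, A.T.map_comp, Category.assoc,
        reassoc_of% map_z_c_app, reassoc_of% hk₂, z_naturality]
  have key₁ : k ≫ a.nat.app (A.T.obj M) ≫ A.T.map (A.s.nat.app (A.T.obj M)) =
      A.T.map (a.nat.app M ≫ A.T.map (A.s.nat.app M)) ≫ cApp A (A.T.obj M) ≫
        A.T.map (cApp A M) := by
    rw [← reassoc_of% key, ← A.T.map_comp, ← hks]
    simp only [A.T.map_comp, Category.assoc]
    rw [reassoc_of% map_map_c]
  have key₂ : k ≫ A.str.π₁.nat.app (A.T.obj M) ≫ pApp A (A.T.obj M) =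
      A.T.map (A.str.π₁.nat.app M ≫ pApp A M) := by
    rw [reassoc_of% hk₁, c_p_app, A.T.map_comp]
  have hxy : x ≫ k = y ≫ k := mono (hx.comp hk) (hy.comp hk)
    (by rw [Category.assoc, Category.assoc, key₁, reassoc_of% e₁])
    (by rw [Category.assoc, Category.assoc, key₂, e₂])
  -- Equality after `k` suffices: since `c` is an involution, each `T (π i)` factors through `k`.
  refine hT.map_hom_ext hx hy fun i => ?_
  have hi : A.T.map ((![A.str.π₁, A.str.π₂] i).nat.app M) =
      k ≫ (![A.str.π₁, A.str.π₂] i).nat.app (A.T.obj M) ≫ cApp A M := by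
    rw [reassoc_of% hkπ i, c_c_app, Category.comp_id]
  rw [hi, reassoc_of% hxy]

end Vertical

/-! ### The tangent structure of `VF(X, T)`. -/

section Structure

variable {A : Tangentad SRCat.{v, max u v}}

/-- The vector field on `T₂ M`, followed by the flip `k : T T₂ ⟶ T₂ T`, is `T₂ v`. The claim is then
naturality of `s` at `v` together with additivity of `c`. It says that the sum respects the vector
fields. -/
theorem s_comp_map_v_c (x : VF A) : A.s.nat.app x.M ≫ A.T.map x.v ≫ cApp A x.M =
    (isFold_T₂ A).vecApp x ≫ A.T.map (A.s.nat.app x.M) := by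
  have hT := isFold_T₂ A
  obtain ⟨k, hk, hkπ, hks⟩ := exists_flip₂ A x.M
  have key : (isFold_T₂ A).vecApp x ≫ k = A.T₂.map x.v := by
    refine hT.hom_ext ((hT.total_vecApp x).comp hk) (A.T₂.total_map x.total) fun i => ?_
    have h := (![A.str.π₁, A.str.π₂] i).nat.naturality x.v
    rw [Category.assoc, hkπ, reassoc_of% (hT.vecApp_map_π i x), c_c_app, Category.comp_id]
    exact h.symm
  have h : A.T₂.map x.v ≫ A.s.nat.app (A.T.obj x.M) = A.s.nat.app x.M ≫ A.T.map x.v :=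
    A.s.nat.naturality x.v
  rw [← reassoc_of% h, ← key, Category.assoc, ← reassoc_of% hks, c_c_app, Category.comp_id]

variable (A)

/-- The 2-fold pullback of the projection of `VF(X, T)`. -/
noncomputable def vfT₂ : vf A ⟶ vf A := vfFold (isFold_T₂ A)

/-- The first projection of `vfT₂`. -/
noncomputable def vfπ₁ : vfT₂ A ⟶ vfT A := vfFoldπ (isFold_T₂ A) 0

/-- The second projection of `vfT₂`. -/
noncomputable def vfπ₂ : vfT₂ A ⟶ vfT A := vfFoldπ (isFold_T₂ A) 1

/-- The zero morphism of `VF(X, T)`. -/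
def vfZ : 𝟙 (vf A) ⟶ vfT A :=
  vfLift₂ (H := 𝟙 (vf A)) (H' := vfT A) (vfForget A ◁ A.z) fun x => by
    change zApp A (VF.M x) ≫ A.T.map (VF.v x) ≫ cApp A (VF.M x) =
      VF.v x ≫ A.T.map (zApp A (VF.M x))
    rw [← z_c_app, reassoc_of% z_naturality]

/-- The sum morphism of `VF(X, T)`. -/
noncomputable def vfS : vfT₂ A ⟶ vfT A :=
  vfLift₂ (H := vfT₂ A) (H' := vfT A) (vfForget A ◁ A.s) s_comp_map_v_c

/-- The vertical lift of `VF(X, T)`. -/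
def vfL : vfT A ⟶ vfT A ≫ vfT A :=
  vfLift₂ (H := vfT A) (H' := vfT A ≫ vfT A) (vfForget A ◁ A.l) fun x => by
    change lApp A (VF.M x) ≫ A.T.map (A.T.map (VF.v x) ≫ cApp A (VF.M x)) ≫
      cApp A (A.T.obj (VF.M x)) = (A.T.map (VF.v x) ≫ cApp A (VF.M x)) ≫ A.T.map (lApp A (VF.M x))
    rw [A.T.map_comp, Category.assoc, Category.assoc, ← reassoc_of% l_naturality, l_c_c_app]

/-- The canonical flip of `VF(X, T)`. -/
def vfC : vfT A ≫ vfT A ⟶ vfT A ≫ vfT A :=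
  vfLift₂ (H := vfT A ≫ vfT A) (H' := vfT A ≫ vfT A) (vfForget A ◁ A.c) fun x => by
    change cApp A (VF.M x) ≫ A.T.map (A.T.map (VF.v x) ≫ cApp A (VF.M x)) ≫
      cApp A (A.T.obj (VF.M x)) = (A.T.map (A.T.map (VF.v x) ≫ cApp A (VF.M x)) ≫
        cApp A (A.T.obj (VF.M x))) ≫ A.T.map (cApp A (VF.M x))
    simp only [A.T.map_comp, Category.assoc]
    rw [c_braid_app, ← reassoc_of% map_map_c]

theorem isPullback_vfT₂ {Y : SRCat.{v, max u v}} (F : Y ⟶ vf A) (m : ℕ) :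
    IsPullback (F ◁ vfπ₁ A ▷ iter (vfT A) m) (F ◁ vfπ₂ A ▷ iter (vfT A) m)
      (F ◁ vfP A ▷ iter (vfT A) m) (F ◁ vfP A ▷ iter (vfT A) m) :=
  isPullback_iff_isFoldPullback.2 (isFoldPullback_vfFold (isFold_T₂ A) F m)

/-- A 2-morphism in the base into `T₂` is compatible with the vector fields when its two
composites with the projections are. -/
theorem comm_of_vfT₂ {Y : SRCat.{v, max u v}} {F H : Y ⟶ vf A} {J : vf A ⟶ vf A} {m : ℕ}
    (hJ : J ≫ vfForget A ≫ A.T = vfForget A ≫ iter A.T m)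
    (a : F ≫ vfForget A ⟶ (H ≫ vfT₂ A ≫ J) ≫ vfForget A) (b₁ b₂ : F ⟶ H ≫ vfT A ≫ J)
    (h₁ : a ≫ (H ◁ vfπ₁ A ▷ J) ▷ vfForget A = b₁ ▷ vfForget A)
    (h₂ : a ≫ (H ◁ vfπ₂ A ▷ J) ▷ vfForget A = b₂ ▷ vfForget A) (y : Y.carrier) :
    a.nat.app y ≫ VF.v ((H ≫ vfT₂ A ≫ J).obj y) = VF.v (F.obj y) ≫ A.T.map (a.nat.app y) :=
  -- The exponent `m` counts the copies of `T` in `J` and one more, under which the two projections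
  -- must remain jointly monic.
  VF.comm_of_jointlyMono (x := F.obj y) (y := J.obj ((vfT₂ A).obj (H.obj y)))
    (E := fun _ => J.obj ((vfT A).obj (H.obj y)))
    (fun i => J.map ((vfFoldπ (isFold_T₂ A) i).nat.app (H.obj y)))
    (vfFold_map_hom_ext (isFold_T₂ A) hJ (H.obj y)) (a.total y)
    (Fin.cons (b₁.nat.app y) (Fin.cons (b₂.nat.app y) Fin.elim0))
    (Fin.forall_fin_two.2 ⟨app_congr h₁ y, app_congr h₂ y⟩)

theorem vf_s_assoc {P : vf A ⟶ vf A} (a b : P ⟶ vfT₂ A) (hab : a ≫ vfπ₂ A = b ≫ vfπ₁ A) :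
    ∃ d e : P ⟶ vfT₂ A, d ≫ vfπ₁ A = a ≫ vfS A ∧ d ≫ vfπ₂ A = b ≫ vfπ₂ A ∧
      e ≫ vfπ₁ A = a ≫ vfπ₁ A ∧ e ≫ vfπ₂ A = b ≫ vfS A ∧ d ≫ vfS A = e ≫ vfS A := by
  have hpb : IsPullback (vfπ₁ A) (vfπ₂ A) (vfP A) (vfP A) := isPullback_vfT₂ A (𝟙 _) 0
  have hs : vfS A ≫ vfP A = vfπ₁ A ≫ vfP A := vf_hom₂_ext fun x => app_congr A.str.s_p (VF.M x)
  have hd : (a ≫ vfS A) ≫ vfP A = (b ≫ vfπ₂ A) ≫ vfP A := by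
    rw [Category.assoc, hs, hpb.w, ← Category.assoc, hab, Category.assoc, hpb.w, Category.assoc]
  have he : (a ≫ vfπ₁ A) ≫ vfP A = (b ≫ vfS A) ≫ vfP A := by
    rw [Category.assoc, Category.assoc, hs, hpb.w, ← Category.assoc, hab, Category.assoc, hpb.w]
  refine ⟨hpb.lift _ _ hd, hpb.lift _ _ he, hpb.lift_fst _ _ _, hpb.lift_snd _ _ _,
    hpb.lift_fst _ _ _, hpb.lift_snd _ _ _, vf_hom₂_ext fun x => ?_⟩
  have app {F G : vf A ⟶ vf A} {η θ : F ⟶ G} (h : η = θ) :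
    VF.Hom.f (η.nat.app x) = VF.Hom.f (θ.nat.app x) := h ▸ rfl
  -- Here `P` is an endomorphism of `VF(X, T)` and need not come from one of `X`, so the axiom of
  -- the base enters only through generalized elements at each object.
  exact s_assoc_app ((vfForget A).total_map (a.total x)) ((vfForget A).total_map (b.total x))
    ((vfForget A).total_map ((hpb.lift _ _ hd).total x))
    ((vfForget A).total_map ((hpb.lift _ _ he).total x)) (app hab)
    (app (hpb.lift_fst _ _ hd)) (app (hpb.lift_snd _ _ hd)) (app (hpb.lift_fst _ _ he))
    (app (hpb.lift_snd _ _ he))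

/-- As in the next four existence statements, the witness is the one of the base. It respects the
vector fields because its two projections are 2-morphisms already known to do so, and its equations
are those of the base because `U` is faithful. -/
theorem vf_s_unit : ∃ a : vfT A ⟶ vfT₂ A,
    a ≫ vfπ₁ A = vfP A ≫ vfZ A ∧ a ≫ vfπ₂ A = 𝟙 (vfT A) ∧ a ≫ vfS A = 𝟙 (vfT A) := by
  obtain ⟨a, h1, h2, h3⟩ := A.str.s_unit
  exact ⟨vfLift₂ (H := vfT A) (H' := vfT₂ A) (vfForget A ◁ a)
      (comm_of_vfT₂ A (F := vfT A) (H := 𝟙 _) (J := 𝟙 _) (m := 1) rfl (vfForget A ◁ a)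
        (vfP A ≫ vfZ A) (𝟙 (vfT A)) (hom₂_ext fun x => app_congr h1 (VF.M x))
        (hom₂_ext fun x => app_congr h2 (VF.M x))),
    vf_hom₂_ext fun x => app_congr h1 (VF.M x), vf_hom₂_ext fun x => app_congr h2 (VF.M x),
    vf_hom₂_ext fun x => app_congr h3 (VF.M x)⟩

theorem vf_s_comm : ∃ a : vfT₂ A ⟶ vfT₂ A,
    a ≫ vfπ₁ A = vfπ₂ A ∧ a ≫ vfπ₂ A = vfπ₁ A ∧ a ≫ vfS A = vfS A := by
  obtain ⟨a, h1, h2, h3⟩ := A.str.s_comm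
  exact ⟨vfLift₂ (H := vfT₂ A) (H' := vfT₂ A) (vfForget A ◁ a)
      (comm_of_vfT₂ A (F := vfT₂ A) (H := 𝟙 _) (J := 𝟙 _) (m := 1) rfl (vfForget A ◁ a)
        (vfπ₂ A) (vfπ₁ A) (hom₂_ext fun x => app_congr h1 (VF.M x))
        (hom₂_ext fun x => app_congr h2 (VF.M x))),
    vf_hom₂_ext fun x => app_congr h1 (VF.M x), vf_hom₂_ext fun x => app_congr h2 (VF.M x),
    vf_hom₂_ext fun x => app_congr h3 (VF.M x)⟩

theorem vf_s_l : ∃ a : vfT₂ A ⟶ vfT₂ A ≫ vfT A, a ≫ vfπ₁ A ▷ vfT A = vfπ₁ A ≫ vfL A ∧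
    a ≫ vfπ₂ A ▷ vfT A = vfπ₂ A ≫ vfL A ∧ vfS A ≫ vfL A = a ≫ vfS A ▷ vfT A := by
  obtain ⟨a, h1, h2, h3⟩ := A.str.s_l
  exact ⟨vfLift₂ (H := vfT₂ A) (H' := vfT₂ A ≫ vfT A) (vfForget A ◁ a)
      (comm_of_vfT₂ A (F := vfT₂ A) (H := 𝟙 _) (J := vfT A) (m := 2) rfl (vfForget A ◁ a)
        (vfπ₁ A ≫ vfL A) (vfπ₂ A ≫ vfL A) (hom₂_ext fun x => app_congr h1 (VF.M x))
        (hom₂_ext fun x => app_congr h2 (VF.M x))),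
    vf_hom₂_ext fun x => app_congr h1 (VF.M x), vf_hom₂_ext fun x => app_congr h2 (VF.M x),
    vf_hom₂_ext fun x => app_congr h3 (VF.M x)⟩

theorem vf_s_c : ∃ a : vfT₂ A ≫ vfT A ⟶ vfT A ≫ vfT₂ A,
    a ≫ vfT A ◁ vfπ₁ A = vfπ₁ A ▷ vfT A ≫ vfC A ∧ a ≫ vfT A ◁ vfπ₂ A = vfπ₂ A ▷ vfT A ≫ vfC A ∧
      vfS A ▷ vfT A ≫ vfC A = a ≫ vfT A ◁ vfS A := by
  obtain ⟨a, h1, h2, h3⟩ := A.str.s_c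
  exact ⟨vfLift₂ (H := vfT₂ A ≫ vfT A) (H' := vfT A ≫ vfT₂ A) (vfForget A ◁ a)
      (comm_of_vfT₂ A (F := vfT₂ A ≫ vfT A) (H := vfT A) (J := 𝟙 _) (m := 1) rfl (vfForget A ◁ a)
        (vfπ₁ A ▷ vfT A ≫ vfC A) (vfπ₂ A ▷ vfT A ≫ vfC A)
        (hom₂_ext fun x => app_congr h1 (VF.M x)) (hom₂_ext fun x => app_congr h2 (VF.M x))),
    vf_hom₂_ext fun x => app_congr h1 (VF.M x), vf_hom₂_ext fun x => app_congr h2 (VF.M x),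
    vf_hom₂_ext fun x => app_congr h3 (VF.M x)⟩

theorem vf_l_universal : ∃ a : vfT₂ A ⟶ vfT₂ A ≫ vfT A,
    a ≫ vfπ₁ A ▷ vfT A = vfπ₁ A ≫ vfL A ∧
    a ≫ vfπ₂ A ▷ vfT A = vfπ₂ A ≫ (ρ_ (vfT A)).inv ≫ vfT A ◁ vfZ A ∧
      ∀ {Y : SRCat.{v, max u v}} (F : Y ⟶ vf A), IsPullback (F ◁ (a ≫ vfS A ▷ vfT A))
        (F ◁ (vfπ₁ A ≫ vfP A)) (F ◁ (vfP A ▷ vfT A ≫ (λ_ (vfT A)).hom)) (F ◁ vfZ A) := by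
  obtain ⟨a, h1, h2, h3⟩ := A.str.l_universal
  exact ⟨vfLift₂ (H := vfT₂ A) (H' := vfT₂ A ≫ vfT A) (vfForget A ◁ a)
      (comm_of_vfT₂ A (F := vfT₂ A) (H := 𝟙 _) (J := vfT A) (m := 2) rfl (vfForget A ◁ a)
        (vfπ₁ A ≫ vfL A) (vfπ₂ A ≫ (ρ_ (vfT A)).inv ≫ vfT A ◁ vfZ A)
        (hom₂_ext fun x => app_congr h1 (VF.M x)) (hom₂_ext fun x => app_congr h2 (VF.M x))),
    vf_hom₂_ext fun x => app_congr h1 (VF.M x), vf_hom₂_ext fun x => app_congr h2 (VF.M x),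
    -- Preservation of this pullback by `T` is not part of the axioms; the monicity under `T` comes
    -- from the flip argument.
    fun F => isPullback_of_forget (h3 (F ≫ vfForget A))
      fun y _ _ _ ha hb e₁ e₂ => map_hom_ext_of_l_universal h1 h2 h3 ha hb e₁ e₂⟩

/-- The tangent structure of `VF(X, T)`. -/
noncomputable def vfStructure : TangentStructure (vf A) where
  T := vfT A
  p := vfP A
  T₂ := vfT₂ A
  π₁ := vfπ₁ A
  π₂ := vfπ₂ A
  z := vfZ A
  s := vfS A
  l := vfL A
  c := vfC A
  isPullback F m := isPullback_vfT₂ A F m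
  exists_foldPullback n hn := by
    obtain ⟨P, π, h⟩ := A.str.exists_foldPullback n hn
    have hP : IsFold A π := fun _ F m => h F m
    exact ⟨vfFold hP, vfFoldπ hP, fun F m => isFoldPullback_vfFold hP F m⟩
  z_p := vf_hom₂_ext fun x => app_congr A.str.z_p (VF.M x)
  s_p := vf_hom₂_ext fun x => app_congr A.str.s_p (VF.M x)
  s_assoc a b h := vf_s_assoc A a b h
  s_unit := vf_s_unit A
  s_comm := vf_s_comm A
  l_p := vf_hom₂_ext fun x => app_congr A.str.l_p (VF.M x)
  z_l := vf_hom₂_ext fun x => app_congr A.str.z_l (VF.M x)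
  s_l := vf_s_l A
  c_p := vf_hom₂_ext fun x => app_congr A.str.c_p (VF.M x)
  z_c := vf_hom₂_ext fun x => app_congr A.str.z_c (VF.M x)
  s_c := vf_s_c A
  l_l := vf_hom₂_ext fun x => app_congr A.str.l_l (VF.M x)
  l_c := vf_hom₂_ext fun x => app_congr A.str.l_c (VF.M x)
  l_c_c := vf_hom₂_ext fun x => app_congr A.str.l_c_c (VF.M x)
  c_c := vf_hom₂_ext fun x => app_congr A.str.c_c (VF.M x)
  c_braid := vf_hom₂_ext fun x => app_congr A.str.c_braid (VF.M x)
  l_universal := vf_l_universal A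

end Structure

end SRCat

/-- Lifting a vector field and applying `Γ` returns the same 1-morphism definitionally, while the
law and the vector field return only up to composition with identity components of coherence cells.
-/
theorem VectorField.mk_congr {K : Type u} [Bicategory.{w, v} K] {A B : Tangentad K} {F : A.X ⟶ B.X}
    {law law' : A.T ≫ F ⟶ F ≫ B.T} (h : law = law') {hl : IsLaxLaw law} {hl' : IsLaxLaw law'}
    {u : (⟨F, law, hl⟩ : LaxMor A B) ⟶ (⟨F, law, hl⟩ : LaxMor A B).tangent}
    {u' : (⟨F, law', hl'⟩ : LaxMor A B) ⟶ (⟨F, law', hl'⟩ : LaxMor A B).tangent}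
    (hu : u.φ = u'.φ) (hs : u.φ ≫ F ◁ B.p ≫ (ρ_ F).hom = 𝟙 F)
    (hs' : u'.φ ≫ F ◁ B.p ≫ (ρ_ F).hom = 𝟙 F) :
    (⟨⟨F, law, hl⟩, u, hs⟩ : VectorField A B) = ⟨⟨F, law', hl'⟩, u', hs'⟩ := by
  subst h
  obtain rfl : u = u' := LaxMor.Hom.ext hu
  rfl

namespace SRCat

/-! ### Universality of the vector field `(M, v) ↦ v`. -/

section Universal

variable (A : Tangentad SRCat.{v, max u v})

/-- The identity distributive law of the forgetful functor. -/
def vfLaw : (vfStructure A).T ≫ vfForget A ⟶ vfForget A ≫ A.T := 𝟙 (vfForget A ≫ A.T)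

theorem isLaxLaw_vfLaw : IsLaxLaw (A := vfTangentad A (vfStructure A)) (B := A) (vfLaw A) where
  p := hom₂_ext fun _ => Category.id_comp _
  z := hom₂_ext fun _ => congrArg (fun t => 𝟙 _ ≫ t) (Category.comp_id _)
  s := ⟨𝟙 (vfForget A ≫ A.T₂),
    hom₂_ext fun _ => (Category.id_comp _).trans (Category.comp_id _).symm,
    hom₂_ext fun _ => (Category.id_comp _).trans (Category.comp_id _).symm,
    hom₂_ext fun _ => (Category.comp_id _).trans (Category.id_comp _).symm⟩
  l := hom₂_ext fun x => by
    change lApp A (VF.M x) ≫ 𝟙 _ ≫ 𝟙 _ ≫ 𝟙 _ ≫ A.T.map (𝟙 (A.T.obj (VF.M x))) ≫ 𝟙 _ =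
      𝟙 _ ≫ lApp A (VF.M x)
    simp
  c := hom₂_ext fun x => by
    change cApp A (VF.M x) ≫ 𝟙 _ ≫ 𝟙 _ ≫ 𝟙 _ ≫ A.T.map (𝟙 (A.T.obj (VF.M x))) ≫ 𝟙 _ =
      (𝟙 _ ≫ 𝟙 _ ≫ 𝟙 _ ≫ A.T.map (𝟙 (A.T.obj (VF.M x))) ≫ 𝟙 _) ≫ cApp A (VF.M x)
    simp

/-- The field on `T M` is `c ∘ T v`, and the law of `T̄ U` contributes a second `c`; involutivity
leaves `T v`. -/
theorem vfLaw_vfUniv : vfLaw A ≫ vfUniv A ▷ A.T = (vfStructure A).T ◁ vfUniv A ≫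
    (LaxMor.tangent (A := vfTangentad A (vfStructure A))
      ⟨vfForget A, vfLaw A, isLaxLaw_vfLaw A⟩).law :=
  hom₂_ext fun x => by
    change 𝟙 _ ≫ A.T.map (VF.v x) = (A.T.map (VF.v x) ≫ cApp A (VF.M x)) ≫
      𝟙 _ ≫ A.T.map (𝟙 (A.T.obj (VF.M x))) ≫ 𝟙 _ ≫ cApp A (VF.M x) ≫ 𝟙 _
    simp [c_c_app]

/-- The universal vector field. -/
noncomputable abbrev vfUniversal : VectorField (vfTangentad A (vfStructure A)) A :=
  vfVectorField A (vfStructure A) (vfLaw A) (isLaxLaw_vfLaw A) (vfLaw_vfUniv A)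

variable {A} {C : Tangentad SRCat.{v, max u v}}

theorem vectorField_section (V : VectorField C A) (y : C.X.carrier) :
    V.vec.nat.app y ≫ pApp A (V.G.F.obj y) = 𝟙 (V.G.F.obj y) := by
  have h : V.vec.nat.app y ≫ pApp A (V.G.F.obj y) ≫ 𝟙 (V.G.F.obj y) = 𝟙 (V.G.F.obj y) :=
    app_congr V.section_p y
  rwa [Category.comp_id] at h

theorem comp_c_eq_of_eq_comp_c {M W W' : A.X.carrier} {f : W ⟶ A.T.obj M}
    {g : A.T.obj M ⟶ A.T.obj (A.T.obj M)} {f' : W ⟶ W'} {g' : W' ⟶ A.T.obj (A.T.obj M)}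
    (h : f ≫ g = f' ≫ 𝟙 _ ≫ g' ≫ 𝟙 _ ≫ cApp A M ≫ 𝟙 _) : f ≫ g ≫ cApp A M = f' ≫ g' := by
  simp only [Category.id_comp, Category.comp_id] at h
  rw [reassoc_of% h, c_c_app, Category.comp_id]

/-- Moving the flip to the other side turns the tangent 2-morphism condition on `u` into the
condition that each component of the law is a morphism of `VF(X, T)`. This is what makes the law
liftable. -/
theorem vectorField_law (V : VectorField C A) (y : C.X.carrier) :
    V.G.law.nat.app y ≫ A.T.map (V.vec.nat.app y) ≫ cApp A (V.G.F.obj y) =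
      V.vec.nat.app (C.T.obj y) ≫ A.T.map (V.G.law.nat.app y) :=
  comp_c_eq_of_eq_comp_c (app_congr V.u.comm y)

/-- The lift to `VF(X, T)` of a lax tangent morphism with a vector field. -/
noncomputable def vfLaxLift (V : VectorField C A) : LaxMor C (vfTangentad A (vfStructure A)) where
  F := vfLift V.G.F V.vec (vectorField_section V)
  law := vfLift₂ (H := C.T ≫ vfLift V.G.F V.vec (vectorField_section V))
    (H' := vfLift V.G.F V.vec (vectorField_section V) ≫ vfT A) V.G.law (vectorField_law V)
  isLaxLaw :=
    { p := vf_hom₂_ext fun y => app_congr V.G.isLaxLaw.p y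
      z := vf_hom₂_ext fun y => app_congr V.G.isLaxLaw.z y
      s := by
        obtain ⟨a, h1, h2, h3⟩ := V.G.isLaxLaw.s
        let H : C.X ⟶ vf A := vfLift V.G.F V.vec (vectorField_section V)
        let law : C.T ≫ H ⟶ H ≫ vfT A := vfLift₂ V.G.law (vectorField_law V)
        exact ⟨vfLift₂ (H := C.T₂ ≫ H) (H' := H ≫ vfT₂ A) a
            (comm_of_vfT₂ A (F := C.T₂ ≫ H) (H := H) (J := 𝟙 _) (m := 1) rfl a
              (C.str.π₁ ▷ H ≫ law) (C.str.π₂ ▷ H ≫ law) (hom₂_ext fun y => app_congr h1 y)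
              (hom₂_ext fun y => app_congr h2 y)),
          vf_hom₂_ext fun y => app_congr h1 y, vf_hom₂_ext fun y => app_congr h2 y,
          vf_hom₂_ext fun y => app_congr h3 y⟩
      l := vf_hom₂_ext fun y => app_congr V.G.isLaxLaw.l y
      c := vf_hom₂_ext fun y => app_congr V.G.isLaxLaw.c y }

theorem Γ_law_app (H : LaxMor C (vfTangentad A (vfStructure A))) (y : C.X.carrier) :
    (((vfUniversal A).Γ C).obj H).G.law.nat.app y = VF.Hom.f (H.law.nat.app y) := by
  change 𝟙 _ ≫ VF.Hom.f (H.law.nat.app y) ≫ 𝟙 _ ≫ 𝟙 _ ≫ 𝟙 _ = _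
  simp

theorem Γ_vec_app (H : LaxMor C (vfTangentad A (vfStructure A))) (y : C.X.carrier) :
    (((vfUniversal A).Γ C).obj H).vec.nat.app y = VF.v (H.F.obj y) :=
  Category.comp_id (VF.v (H.F.obj y))

/-- The types of the two laws depend on `w` and `w'`, so the laws are compared after forgetting to
the base, where both have the same type. -/
theorem LaxMor.mk_vfLift_congr {F : C.X ⟶ A.X} {w w' : F ⟶ F ≫ A.T} (h : w = w')
    {hw : ∀ y, w.nat.app y ≫ pApp A (F.obj y) = 𝟙 (F.obj y)}
    {hw' : ∀ y, w'.nat.app y ≫ pApp A (F.obj y) = 𝟙 (F.obj y)}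
    {law : C.T ≫ vfLift F w hw ⟶ vfLift F w hw ≫ vfT A}
    {law' : C.T ≫ vfLift F w' hw' ⟶ vfLift F w' hw' ≫ vfT A}
    (hlaw : law ▷ vfForget A = law' ▷ vfForget A)
    (hl : IsLaxLaw (A := C) (B := vfTangentad A (vfStructure A)) law)
    (hl' : IsLaxLaw (A := C) (B := vfTangentad A (vfStructure A)) law') :
    (⟨vfLift F w hw, law, hl⟩ : LaxMor C (vfTangentad A (vfStructure A))) =
      ⟨vfLift F w' hw', law', hl'⟩ := by
  subst h
  obtain rfl : law = law' := vf_hom₂_ext fun y => app_congr hlaw y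
  rfl

theorem vfLaxLift_Γ (H : LaxMor C (vfTangentad A (vfStructure A))) :
    vfLaxLift (((vfUniversal A).Γ C).obj H) = H :=
  -- By eta for structures, `H.F` is definitionally the lift of `H.F ≫ vfForget A` along `H.F ◁
  -- vfUniv A`.
  LaxMor.mk_vfLift_congr (F := H.F ≫ vfForget A) (w' := H.F ◁ vfUniv A)
    (hw' := fun y => VF.section_p (H.F.obj y))
    (law := (vfLaxLift (((vfUniversal A).Γ C).obj H)).law) (law' := H.law)
    (hom₂_ext (Γ_vec_app H)) (hom₂_ext (Γ_law_app H)) (vfLaxLift _).isLaxLaw H.isLaxLaw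

theorem Γ_vfLaxLift (V : VectorField C A) : ((vfUniversal A).Γ C).obj (vfLaxLift V) = V :=
  VectorField.mk_congr (hom₂_ext (Γ_law_app (vfLaxLift V))) (hom₂_ext (Γ_vec_app (vfLaxLift V))) _ _

theorem eq_of_comp_id_comp {D : Type*} [Category* D] {X X' Y Z : D} {f : X ⟶ Y} {g : Y ⟶ Z}
    {f' : X ⟶ X'} {g' : X' ⟶ Z} (h : (f ≫ 𝟙 Y) ≫ g = f' ≫ g' ≫ 𝟙 Z) : f' ≫ g' = f ≫ g := by
  simpa using h.symm

theorem Γ_hom_comm {H H' : LaxMor C (vfTangentad A (vfStructure A))}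
    (g : ((vfUniversal A).Γ C).obj H ⟶ ((vfUniversal A).Γ C).obj H') (y : C.X.carrier) :
    g.f.φ.nat.app y ≫ VF.v (H'.F.obj y) = VF.v (H.F.obj y) ≫ A.T.map (g.f.φ.nat.app y) :=
  eq_of_comp_id_comp (app_congr g.comm y)

theorem Γ_hom_law {H H' : LaxMor C (vfTangentad A (vfStructure A))}
    (g : ((vfUniversal A).Γ C).obj H ⟶ ((vfUniversal A).Γ C).obj H') (y : C.X.carrier) :
    VF.Hom.f (H.law.nat.app y) ≫ A.T.map (g.f.φ.nat.app y) =
      g.f.φ.nat.app (C.T.obj y) ≫ VF.Hom.f (H'.law.nat.app y) := by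
  have h : (((vfUniversal A).Γ C).obj H).G.law.nat.app y ≫ A.T.map (g.f.φ.nat.app y) =
    g.f.φ.nat.app (C.T.obj y) ≫ (((vfUniversal A).Γ C).obj H').G.law.nat.app y :=
      app_congr g.f.comm y
  rw [Γ_law_app, Γ_law_app] at h
  exact h

theorem isUniversal_vfUniversal : (vfUniversal A).IsUniversal := fun _ =>
  { faithful := ⟨fun {_ _ _ _} h => LaxMor.Hom.ext (vf_hom₂_ext fun y =>
      congrArg (fun t => t.f.φ.nat.app y) h)⟩
    full := ⟨fun {_ _} g => ⟨⟨vfLift₂ g.f.φ (Γ_hom_comm g), vf_hom₂_ext (Γ_hom_law g)⟩, rfl⟩⟩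
    bijective_obj := Function.bijective_iff_has_inverse.2 ⟨vfLaxLift, vfLaxLift_Γ, Γ_vfLaxLift⟩ }

end Universal

end SRCat

theorem Insert.mk_congr {K : Type u} [Bicategory.{w, v} K] {Y X X' : K} {F G : X ⟶ X'} {H : Y ⟶ X}
    {τ τ' : H ≫ F ⟶ H ≫ G} (h : τ = τ') : (⟨H, τ⟩ : Insert Y F G) = ⟨H, τ'⟩ := by
  rw [h]

namespace SRCat

open Tangentads.RestrictionCategory (res)

/-! ### Inserters. -/

section Inserter

variable {X X' : SRCat.{v, max u v}}

/-- An object of the inserter of `F` and `G`. -/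
structure Ins (F G : X ⟶ X') : Type (max u v) where
  M : X.carrier
  t : F.obj M ⟶ G.obj M
  total : Total t

namespace Ins

variable {F G : X ⟶ X'}

/-- A morphism of the inserter. -/
@[ext]
structure Hom (x y : Ins F G) where
  f : x.M ⟶ y.M
  comm : F.map f ≫ y.t = x.t ≫ G.map f

/-- Totality of `y.t` gives `F f ≫ y.t` the same restriction idempotent as `F f`, so restriction
idempotents lift to the inserter with no extra condition on morphisms. -/
theorem comm_res {x y : Ins F G} (f : Hom x y) : F.map (res f.f) ≫ x.t = x.t ≫ G.map (res f.f) := by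
  rw [F.map_res, G.map_res, RestrictionCategory.comp_res, ← f.comm, res_comp_of_total _ y.total]

instance : Category (Ins F G) where
  Hom := Hom
  id x := ⟨𝟙 x.M, by rw [F.map_id, G.map_id, Category.id_comp, Category.comp_id]⟩
  comp {x y w} f g := ⟨f.f ≫ g.f, by
    rw [F.map_comp, G.map_comp, Category.assoc, g.comm, ← Category.assoc, f.comm, Category.assoc]⟩
  id_comp f := Hom.ext (Category.id_comp f.f)
  comp_id f := Hom.ext (Category.comp_id f.f)
  assoc f g h := Hom.ext (Category.assoc f.f g.f h.f)

instance : RestrictionCategory (Ins F G) where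
  res f := ⟨res f.f, comm_res f⟩
  res_comp_self f := Hom.ext (RestrictionCategory.res_comp_self f.f)
  res_comm f g := Hom.ext (RestrictionCategory.res_comm f.f g.f)
  res_res_comp f g := Hom.ext (RestrictionCategory.res_res_comp f.f g.f)
  comp_res f g := Hom.ext (RestrictionCategory.comp_res f.f g.f)

instance : SplitRestrictionCategory (Ins F G) where
  split {x} e he := by
    obtain ⟨E, r, m, h1, h2⟩ := SplitRestrictionCategory.split e.f (congrArg Hom.f he)
    have hr : r ≫ m ≫ r = r := by rw [h1, Category.comp_id]
    have hm : m ≫ e.f = m := by rw [← h2, reassoc_of% h1]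
    have hmt : F.map m ≫ x.t = (F.map m ≫ x.t ≫ G.map r) ≫ G.map m := by
      rw [Category.assoc, Category.assoc, ← G.map_comp, h2, ← e.comm, ← Category.assoc,
        ← F.map_comp, hm]
    have hmTotal : Total m := total_of_comp_eq_id h1
    -- The retraction `r` need not be total. Composing with the total `G m` gives back the total `F
    -- m ≫ x.t`, and composing with a total morphism does not change the restriction idempotent.
    have ht : Total (F.map m ≫ x.t ≫ G.map r) := by
      have h : Total (F.map m ≫ x.t) := (F.total_map hmTotal).comp x.total
      rw [hmt] at h
      exact (res_comp_of_total _ (G.total_map hmTotal)).symm.trans h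
    exact ⟨⟨E, F.map m ≫ x.t ≫ G.map r, ht⟩, ⟨r, by
      change F.map r ≫ F.map m ≫ x.t ≫ G.map r = x.t ≫ G.map r
      rw [← F.map_comp_assoc, h2, reassoc_of% e.comm, ← G.map_comp, ← h2, Category.assoc, hr]⟩,
      ⟨m, hmt⟩, Hom.ext h1, Hom.ext h2⟩

end Ins

variable (F G : X ⟶ X')

/-- The inserter of `F` and `G`. -/
def inserter : SRCat.{v, max u v} := ⟨Ins F G⟩

/-- The forgetful functor of the inserter. -/
def inserterForget : inserter F G ⟶ X :=
  { obj := fun x => Ins.M x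
    map := fun f => Ins.Hom.f f
    map_id := fun _ => rfl
    map_comp := fun _ _ => rfl
    map_res := fun _ => rfl : RestrictionFunctor _ _ }

/-- The universal 2-morphism of the inserter. -/
def inserterUniv : inserterForget F G ≫ F ⟶ inserterForget F G ≫ G :=
  { nat :=
      { app := fun x => Ins.t x
        naturality := fun _ _ f => Ins.Hom.comm f }
    total := fun x => Ins.total x : TotalNatTrans _ _ }

variable {F G} {Y : SRCat.{v, max u v}}

/-- The 1-morphism into the inserter induced by a 2-morphism. -/
def inserterLift (H : Y ⟶ X) (τ : H ≫ F ⟶ H ≫ G) : Y ⟶ inserter F G :=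
  { obj := fun y => (⟨H.obj y, τ.nat.app y, τ.total y⟩ : Ins F G)
    map := fun f => (⟨H.map f, τ.nat.naturality f⟩ : Ins.Hom _ _)
    map_id := fun y => Ins.Hom.ext (H.map_id y)
    map_comp := fun f g => Ins.Hom.ext (H.map_comp f g)
    map_res := fun f => Ins.Hom.ext (H.map_res f) : RestrictionFunctor _ _ }

/-- The 2-morphism between 1-morphisms into the inserter induced by a compatible 2-morphism. -/
def inserterLift₂ {H H' : Y ⟶ inserter F G}
    (φ : H ≫ inserterForget F G ⟶ H' ≫ inserterForget F G)
    (h : ∀ y, F.map (φ.nat.app y) ≫ Ins.t (H'.obj y) = Ins.t (H.obj y) ≫ G.map (φ.nat.app y)) :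
    H ⟶ H' :=
  { nat :=
      { app := fun y => (⟨φ.nat.app y, h y⟩ : Ins.Hom _ _)
        naturality := fun _ _ f => Ins.Hom.ext (φ.nat.naturality f) }
    total := fun y => Ins.Hom.ext (φ.total y) : TotalNatTrans H H' }

theorem comparison_τ (H : Y ⟶ inserter F G) :
    ((Insert.comparison Y (inserterForget F G) (inserterUniv F G)).obj H).τ =
      H ◁ inserterUniv F G :=
  hom₂_ext fun _ => (Category.id_comp _).trans (Category.comp_id _)

theorem inserterHom_comm {H H' : Y ⟶ inserter F G}
    (g : (Insert.comparison Y (inserterForget F G) (inserterUniv F G)).obj H ⟶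
      (Insert.comparison Y (inserterForget F G) (inserterUniv F G)).obj H') (y : Y.carrier) :
    F.map (g.φ.nat.app y) ≫ Ins.t (H'.obj y) = Ins.t (H.obj y) ≫ G.map (g.φ.nat.app y) := by
  have h := g.comm
  rw [comparison_τ, comparison_τ] at h
  exact (app_congr h y).symm

theorem isInserter_inserter : IsInserter (inserterForget F G) (inserterUniv F G) := fun _ =>
  { faithful := ⟨fun {_ _ _ _} h => hom₂_ext fun y =>
      Ins.Hom.ext (congrArg (fun t => t.φ.nat.app y) h)⟩
    full := ⟨fun {_ _} g => ⟨inserterLift₂ g.φ (inserterHom_comm g), rfl⟩⟩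
    bijective_obj := Function.bijective_iff_has_inverse.2 ⟨fun B => inserterLift B.H B.τ,
      fun H => congrArg (inserterLift (H ≫ inserterForget F G)) (comparison_τ H),
      fun B => Insert.mk_congr (comparison_τ (inserterLift B.H B.τ))⟩ }

end Inserter

/-! ### Equifiers. -/

section Equifier

variable {X X' : SRCat.{v, u}} {F G : X ⟶ X'}

/-- An object of the equifier of `φ` and `ψ`. -/
structure Eqf (φ ψ : F ⟶ G) : Type u where
  M : X.carrier
  eq : φ.nat.app M = ψ.nat.app M

variable {φ ψ : F ⟶ G}

instance : RestrictionCategory (Eqf φ ψ) where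
  Hom x y := x.M ⟶ y.M
  id x := 𝟙 x.M
  comp f g := f ≫ g
  id_comp f := Category.id_comp f
  comp_id f := Category.comp_id f
  assoc f g h := Category.assoc f g h
  res {x y} f := res (X := x.M) (Y := y.M) f
  res_comp_self f := RestrictionCategory.res_comp_self (C := X.carrier) f
  res_comm f g := RestrictionCategory.res_comm (C := X.carrier) f g
  res_res_comp f g := RestrictionCategory.res_res_comp (C := X.carrier) f g
  comp_res f g := RestrictionCategory.comp_res (C := X.carrier) f g

/-- By naturality the component at a retract is determined by the component at the larger object.
Hence the equifier is closed under splittings. -/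
theorem app_eq_of_retract {E M : X.carrier} {m : E ⟶ M} {r : M ⟶ E} (h : m ≫ r = 𝟙 E)
    (hM : φ.nat.app M = ψ.nat.app M) : φ.nat.app E = ψ.nat.app E := by
  have key (η : F ⟶ G) : η.nat.app E = F.map m ≫ η.nat.app M ≫ G.map r := by
    have hr : F.map r ≫ η.nat.app E = η.nat.app M ≫ G.map r := η.nat.naturality r
    rw [← hr, ← F.map_comp_assoc, h, F.map_id, Category.id_comp]
  rw [key φ, key ψ, hM]

instance : SplitRestrictionCategory (Eqf φ ψ) where
  split {x} e he := by
    obtain ⟨E, r, m, h1, h2⟩ := SplitRestrictionCategory.split (C := X.carrier) (M := x.M) e he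
    exact ⟨⟨E, app_eq_of_retract h1 x.eq⟩, r, m, h1, h2⟩

variable (φ ψ)

/-- The equifier of `φ` and `ψ`. -/
def equifier : SRCat.{v, u} := ⟨Eqf φ ψ⟩

/-- The inclusion of the equifier. -/
def equifierForget : equifier φ ψ ⟶ X :=
  { obj := fun x => Eqf.M x
    map := fun {x y} (f : Eqf.M x ⟶ Eqf.M y) => f
    map_id := fun _ => rfl
    map_comp := fun _ _ => rfl
    map_res := fun _ => rfl : RestrictionFunctor _ _ }

variable {φ ψ}

/-- The 1-morphism into the equifier induced by a 1-morphism that equifies `φ` and `ψ`. -/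
def equifierLift {Y : SRCat.{v, u}} (H : Y ⟶ X) (h : H ◁ φ = H ◁ ψ) : Y ⟶ equifier φ ψ :=
  { obj := fun y => (⟨H.obj y, app_congr h y⟩ : Eqf φ ψ)
    map := fun f => H.map f
    map_id := fun y => H.map_id y
    map_comp := fun f g => H.map_comp f g
    map_res := fun f => H.map_res f : RestrictionFunctor _ _ }

theorem isEquifier_equifier : IsEquifier φ ψ (equifierForget φ ψ) :=
  ⟨hom₂_ext fun x => Eqf.eq x, fun _ =>
    { faithful := ⟨fun {_ _ _ _} h => hom₂_ext fun y => congrArg (fun t => t.hom.nat.app y) h⟩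
      full := ⟨fun {H H'} g => ⟨({
          nat :=
            { app := fun y => g.hom.nat.app y
              naturality := fun _ _ f => g.hom.nat.naturality f }
          total := fun y => g.hom.total y } : TotalNatTrans H H'), rfl⟩⟩
      bijective_obj := Function.bijective_iff_has_inverse.2
        ⟨fun B => equifierLift B.obj B.property, fun _ => rfl, fun _ => rfl⟩ }⟩

end Equifier

end SRCat

end Tangentads

/-- `sRCat` admits inserters and equifiers, and it admits the construction of vector fields. For a
tangent split restriction category `A`, i.e. a tangentad of `sRCat`, the split restriction category
`vf A` of pairs `(M, v)` carries a tangent structure `S` with `S.T (M, v) = (T M, c ∘ T v)`, for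
which the forgetful functor is a strict tangent morphism (so the structural transformations of `S`
are those of `A`) and `(M, v) ↦ v` is a universal vector field of `A`. -/
theorem mainTheorem11 :
    AdmitsInserters SRCat.{v, max u v} ∧
    AdmitsEquifiers SRCat.{v, max u v} ∧
    AdmitsVectorFields SRCat.{v, max u v} ∧
    ∀ A : Tangentad SRCat.{v, max u v},
      ∃ (S : TangentStructure (SRCat.vf A))
        (α : S.T ≫ SRCat.vfForget A ⟶ SRCat.vfForget A ≫ A.T)
        (hα : IsLaxLaw (A := SRCat.vfTangentad A S) (B := A) α)
        (hu : α ≫ SRCat.vfUniv A ▷ A.T = S.T ◁ SRCat.vfUniv A ≫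
          (LaxMor.tangent (A := SRCat.vfTangentad A S) ⟨SRCat.vfForget A, α, hα⟩).law),
        S.T = SRCat.vfT A ∧
        (SRCat.vfVectorField A S α hα hu).G.IsStrict ∧
        (SRCat.vfVectorField A S α hα hu).IsUniversal :=
  ⟨fun F G => ⟨_, _, _, SRCat.isInserter_inserter (F := F) (G := G)⟩,
    fun φ ψ => ⟨_, _, SRCat.isEquifier_equifier (φ := φ) (ψ := ψ)⟩,
    fun A => ⟨_, SRCat.vfUniversal A, ⟨rfl, rfl⟩, SRCat.isUniversal_vfUniversal⟩,
    fun A => ⟨SRCat.vfStructure A, SRCat.vfLaw A, SRCat.isLaxLaw_vfLaw A, SRCat.vfLaw_vfUniv A,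
      rfl, ⟨rfl, rfl⟩, SRCat.isUniversal_vfUniversal⟩⟩
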